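/- Let $A=(A_{ij})$ be an $n\times n$ generalized Cartan matrix (integer entries, $A_{ii}=2$, $A_{ij}\le 0$ for $i\ne j$, $A_{ij}=0\Rightarrow A_{ji}=0$), and let $(H,\Pi,\Pi^\vee)$ be a realization of it: $H$ is a complex vector space of dimension $2n-\operatorname{rank}A$, $\alpha_1^\vee,\dots,\alpha_n^\vee\in H$ and $\alpha_1,\dots,\alpha_n\in H^*$ are linearly independent, and $\langle\alpha_j,\alpha_i^\vee\rangle=A_{ij}$. Let $Q^+=\sum_i\mathbb{Z}_{\ge0}\,\alpha_i$. *Construction.* Let $T_0$ be the complex tensor algebra on $\bigoplus_i\mathbb{C}e_i\oplus\bigoplus_i\mathbb{C}f_i\oplus H$, and give $T_0\otimes_{\mathbb{R}}\mathbb{H}$ the bracket $[u\otimes c_1,v\otimes c_2]=uv\otimes c_1c_2-vu\otimes c_2c_1$. Complex scalars act on $T_0$, and $J$ is left multiplication by the quaternion unit $j$ (so $J$ commutes with the complex scalars of $T_0$ and $J^2=-1$). Put $Jx=x\otimes j$ for a generator $x=x\otimes1$ and $\langle\alpha,Jh\rangle=J\langle\alpha,h\rangle$. Let $\hat g(A)$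 be the smallest complex Lie subalgebra containing all generators $x$ and $Jx$; it is stable under $J$. Let $\tilde g(A)=\hat g(A)/\hat I$, where $\hat I$ is the ideal generated by the relations in (3) below. Let $S^+\subset\tilde g(A)$ be the set of all $(\operatorname{ad}\varepsilon_j)^{1-A_{ji}}(\varepsilon_i)$ with $i\ne j$ and $\varepsilon_k\in\{e_k,Je_k\}$, let $S^-$ be the set of all $(\operatorname{ad}\varphi_j)^{1-A_{ji}}(\varphi_i)$ with $i\ne j$ and $\varphi_k\in\{f_k,Jf_k\}$, and let $I^\pm$ be the ideal generated by $S^\pm$. The standard Kac–Moody quaternion Lie algebra is $g(A)=\tilde g(A)/(I^++I^-)$, with the induced operator $J$; all generators below denote their images in $g(A)$. **Theorem.** 1. Let $N^-$, $N^+$ and $K$ be the Lie subalgebras of $g(A)$ generated by $\{f_i,Jf_i\}_i$, by $\{e_i,Je_i\}_i$ and by $H\cup JH$ respectively. Then $g(A)=N^-\oplus K\oplus N^+$ as a vector space. The map $(h,h')\mapsto h+Jh'$ from $H\times H$ to $g(A)$ is injective with image $K$, so that $K=H\oplus JH$ and $H$ embeds in $g(A)$. 2. Let $H_r\subseteq H$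 be a real subspace spanning $H$ over $\mathbb{C}$ (for instance a real form of $H$, or $H$ itself), and for $\alpha\in H^*$ let $g_\alpha=\{x\in g(A): [h,x]=\langle\alpha,h\rangle x\ \text{for all } h\in H_r\}$. Then $$g(A)=\Big(\bigoplus_{0\ne\alpha\in Q^+}g_{-\alpha}\Big)\oplus g_0\oplus\Big(\bigoplus_{0\ne\alpha\in Q^+}g_{\alpha}\Big),\qquad H_r\subset g_0=K .$$ Every $g_\alpha$ is finite-dimensional, and $g_{\alpha}\subset N^{+}$ and $g_{-\alpha}\subset N^-$ for $0\ne\alpha\in Q^+$ (in which case $-\alpha\notin Q^+$). Moreover $x\in g_\alpha$ if and only if $[h+Jh',x]=\langle\alpha,h\rangle x+\langle\alpha,h'\rangle Jx$ for all $h,h'\in H$, and $K$ is a maximal commutative subalgebra of $g(A)$. 3. For all $h,h'\in H$ and all $i,j$, the following hold in $g(A)$: - $[h,h']=[h,Jh']=[Jh,Jh']=0$; - $[h,e_i]=\langle\alpha_i,h\rangle e_i$, $[Jh,e_i]=[h,Je_i]=\langle\alpha_i,h\rangle Je_i$, $[Jh,Je_i]=-\langle\alpha_i,h\rangle e_i$;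 - $[h,f_i]=-\langle\alpha_i,h\rangle f_i$, $[Jh,f_i]=[h,Jf_i]=-\langle\alpha_i,h\rangle Jf_i$, $[Jh,Jf_i]=\langle\alpha_i,h\rangle f_i$; - $[e_i,f_j]=\delta_{ij}\alpha_i^\vee$, $[Je_i,f_j]=[e_i,Jf_j]=\delta_{ij}J\alpha_i^\vee$, $[Je_i,Jf_j]=-\delta_{ij}\alpha_i^\vee$. 4. For all $i\ne j$, $(\operatorname{ad}\varepsilon_j)^{1-A_{ji}}(\varepsilon_i)=0$ and $(\operatorname{ad}\varphi_j)^{1-A_{ji}}(\varphi_i)=0$ in $g(A)$, for every choice of $\varepsilon_k\in\{e_k,Je_k\}$ and $\varphi_k\in\{f_k,Jf_k\}$. -/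

import Mathlib

open scoped TensorProduct Quaternion

noncomputable section

namespace QuatKacMoody

/-- Generalized Cartan matrices. -/
structure IsGCM {n : ℕ} (A : Matrix (Fin n) (Fin n) ℤ) : Prop where
  diag : ∀ i, A i i = 2
  offDiag : ∀ i j, i ≠ j → A i j ≤ 0
  zero_symm : ∀ i j, A i j = 0 → A j i = 0

/-- A realization of `A` on the complex vector space `H` (of dimension `2n - rank A`): independent
simple coroots in `H` and independent simple roots in the dual of `H`, with
`⟨α_j, α_i^∨⟩ = A_ij`. The quaternionic half of the realization is determined by this data through
`⟨α, J h⟩ = J ⟨α, h⟩`. -/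
structure Realization {n : ℕ} (A : Matrix (Fin n) (Fin n) ℤ)
    (H : Type*) [AddCommGroup H] [Module ℂ H] where
  coroot : Fin n → H
  root : Fin n → Module.Dual ℂ H
  coroot_indep : LinearIndependent ℂ coroot
  root_indep : LinearIndependent ℂ root
  pairing : ∀ i j, root j (coroot i) = (A i j : ℂ)
  finrank_add_rank : Module.finrank ℂ H + (A.map (Int.cast : ℤ → ℂ)).rank = 2 * n

section Free

variable (n : ℕ) (H : Type*) [AddCommGroup H] [Module ℂ H]

/-- The complex vector space spanned by the generators `e_i`, `f_i` and `H`. -/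
abbrev GenSpace : Type _ := (Fin n → ℂ) × (Fin n → ℂ) × H

/-- The complex tensor algebra `T₀` on the generators. -/
def T0 : Type _ := TensorAlgebra ℂ (GenSpace n H)

instance : Ring (T0 n H) := inferInstanceAs (Ring (TensorAlgebra ℂ (GenSpace n H)))
instance : Algebra ℂ (T0 n H) := inferInstanceAs (Algebra ℂ (TensorAlgebra ℂ (GenSpace n H)))

/-- The inclusion of the generators into `T₀`. -/
def T0.ι : GenSpace n H →ₗ[ℂ] T0 n H := TensorAlgebra.ι ℂ

/-- The quaternion tensor algebra: the real tensor product of `T₀` with the quaternions. Complex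
scalars act through `T₀`, quaternions through the second factor. The product is
`(u ⊗ c₁) (v ⊗ c₂) = (u v) ⊗ (c₁ c₂)`. -/
def QTensor : Type _ := T0 n H ⊗[ℝ] ℍ[ℝ]

instance : Ring (QTensor n H) := inferInstanceAs (Ring (T0 n H ⊗[ℝ] ℍ[ℝ]))
instance : Algebra ℂ (QTensor n H) := inferInstanceAs (Algebra ℂ (T0 n H ⊗[ℝ] ℍ[ℝ]))

/-- The pure tensor `u ⊗ c`. -/
def tens {n : ℕ} {H : Type*} [AddCommGroup H] [Module ℂ H] (u : T0 n H) (c : ℍ[ℝ]) : QTensor n H :=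
  u ⊗ₜ[ℝ] c

lemma tens_mul_tens (u v : T0 n H) (c d : ℍ[ℝ]) :
    tens u c * tens v d = tens (u * v) (c * d) :=
  Algebra.TensorProduct.tmul_mul_tmul u v c d

lemma tens_neg (u : T0 n H) (c : ℍ[ℝ]) : tens u (-c) = -tens u c := TensorProduct.tmul_neg u c

lemma one_eq_tens : (1 : QTensor n H) = tens 1 1 := rfl

lemma tens_add (u v : T0 n H) (c : ℍ[ℝ]) : tens (u + v) c = tens u c + tens v c :=
  TensorProduct.add_tmul u v c

lemma smul_tens (a : ℂ) (u : T0 n H) (c : ℍ[ℝ]) : tens (a • u) c = a • tens u c :=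
  (TensorProduct.smul_tmul' a u c).symm

/-- The quaternion unit `j`. -/
def unitJ : ℍ[ℝ] := ⟨0, 0, 1, 0⟩

/-- The element `1 ⊗ j`; multiplication by it on the left is the operator `J`. -/
def elJ : QTensor n H := tens 1 unitJ

section

/- Commutator brackets: `[u ⊗ c₁, v ⊗ c₂] = (u v) ⊗ (c₁ c₂) - (v u) ⊗ (c₂ c₁)`. -/
attribute [local instance] LieRing.ofAssociativeRing

/-- The generators `X` (the elements `v ⊗ 1`) and `J X` (the elements `v ⊗ j`). -/
def genSet : Set (QTensor n H) :=
  (Set.range fun v : GenSpace n H => tens (T0.ι n H v) 1) ∪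
    Set.range fun v : GenSpace n H => tens (T0.ι n H v) unitJ

/-- The smallest Lie subalgebra containing `X` and `J X`. -/
def freeSub : LieSubalgebra ℂ (QTensor n H) := LieSubalgebra.lieSpan ℂ _ (genSet n H)

/-- The free quaternion Lie algebra `ĝ` generated by `{X, J X}`. -/
def FreeQ : Type _ := freeSub n H

instance : LieRing (FreeQ n H) := inferInstanceAs (LieRing (freeSub n H))
instance : LieAlgebra ℂ (FreeQ n H) := inferInstanceAs (LieAlgebra ℂ (freeSub n H))

lemma unitJ_mul_unitJ : unitJ * unitJ = -1 := by
  have h1 : unitJ.re = 0 := rfl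
  have h2 : unitJ.imI = 0 := rfl
  have h3 : unitJ.imJ = 1 := rfl
  have h4 : unitJ.imK = 0 := rfl
  rw [Quaternion.ext_iff]
  simp [h1, h2, h3, h4]

lemma elJ_mul_tens (u : T0 n H) (c : ℍ[ℝ]) :
    elJ n H * tens u c = tens u (unitJ * c) := by
  rw [elJ, tens_mul_tens, one_mul]

lemma elJ_mul_elJ : elJ n H * elJ n H = -1 := by
  rw [elJ, tens_mul_tens, unitJ_mul_unitJ, tens_neg, mul_one, one_eq_tens]

lemma elJ_comm {x : QTensor n H} (hx : x ∈ freeSub n H) : elJ n H * x = x * elJ n H := by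
  induction hx using LieSubalgebra.lieSpan_induction with
  | mem y hy =>
    rcases hy with ⟨v, rfl⟩ | ⟨v, rfl⟩ <;> simp [elJ, tens_mul_tens]
  | zero => simp
  | smul a y _ hy => rw [mul_smul_comm, hy, smul_mul_assoc]
  | add y z _ _ hy hz => rw [mul_add, hy, hz, add_mul]
  | lie y z _ _ hy hz =>
    rw [LieRing.of_associative_ring_bracket, mul_sub, sub_mul, ← mul_assoc, ← mul_assoc, hy, hz,
      mul_assoc, mul_assoc, hy, hz, mul_assoc, mul_assoc]

lemma elJ_mul_lie {x y : QTensor n H} (hy : y ∈ freeSub n H) :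
    elJ n H * ⁅x, y⁆ = ⁅elJ n H * x, y⁆ := by
  rw [LieRing.of_associative_ring_bracket, LieRing.of_associative_ring_bracket, mul_sub,
    ← mul_assoc, ← mul_assoc, ← mul_assoc, elJ_comm n H hy]

lemma elJ_mul_mem {x : QTensor n H} (hx : x ∈ freeSub n H) : elJ n H * x ∈ freeSub n H := by
  induction hx using LieSubalgebra.lieSpan_induction with
  | mem y hy =>
    rcases hy with ⟨v, rfl⟩ | ⟨v, rfl⟩
    · simp only [elJ_mul_tens, mul_one]
      exact LieSubalgebra.subset_lieSpan (Or.inr ⟨v, rfl⟩)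
    · simp only [elJ_mul_tens, unitJ_mul_unitJ, tens_neg]
      exact neg_mem (LieSubalgebra.subset_lieSpan (Or.inl ⟨v, rfl⟩))
  | zero => simp
  | smul a y _ hy => rw [mul_smul_comm]; exact (freeSub n H).smul_mem a hy
  | add y z _ _ hy hz => rw [mul_add]; exact add_mem hy hz
  | lie y z _ hz' hy hz => rw [elJ_mul_lie n H hz']; exact LieSubalgebra.lie_mem _ hy hz'

/-- The operator `J` on `ĝ`: left multiplication by the quaternion unit `j`. -/
def freeJ : FreeQ n H →ₗ[ℂ] FreeQ n H where
  toFun x := ⟨elJ n H * x.1, elJ_mul_mem n H x.2⟩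
  map_add' x y := Subtype.ext (mul_add _ _ _)
  map_smul' a x := Subtype.ext (mul_smul_comm _ _ _)

/-- The generator `v ⊗ 1` of `ĝ`. -/
def freeGen : GenSpace n H →ₗ[ℂ] FreeQ n H where
  toFun v := ⟨tens (T0.ι n H v) 1, LieSubalgebra.subset_lieSpan (Or.inl ⟨v, rfl⟩)⟩
  map_add' v w := Subtype.ext ((congrArg (tens · 1) (map_add (T0.ι n H) v w)).trans
    (tens_add n H _ _ _))
  map_smul' a v := Subtype.ext ((congrArg (tens · 1) (map_smul (T0.ι n H) a v)).trans
    (smul_tens n H _ _ _))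

lemma freeJ_freeJ (x : FreeQ n H) : freeJ n H (freeJ n H x) = -x := by
  refine Subtype.ext ((mul_assoc (elJ n H) (elJ n H) x.1).symm.trans ?_)
  exact (congrArg (· * x.1) (elJ_mul_elJ n H)).trans (neg_one_mul x.1)

lemma freeJ_lie (x y : FreeQ n H) : freeJ n H ⁅x, y⁆ = ⁅freeJ n H x, y⁆ :=
  Subtype.ext (elJ_mul_lie n H (x := x.1) y.2)

end

end Free

section Universal

variable {n : ℕ} {A : Matrix (Fin n) (Fin n) ℤ} {H : Type*} [AddCommGroup H] [Module ℂ H]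

/-- The free generators `ê_i`. -/
def eHat (H : Type*) [AddCommGroup H] [Module ℂ H] (i : Fin n) : FreeQ n H :=
  freeGen n H (Pi.single i 1, 0, 0)

/-- The free generators `f̂_i`. -/
def fHat (H : Type*) [AddCommGroup H] [Module ℂ H] (i : Fin n) : FreeQ n H :=
  freeGen n H (0, Pi.single i 1, 0)

/-- The free generators `ĥ`. -/
def hHat (n : ℕ) (h : H) : FreeQ n H := freeGen n H (0, 0, h)

/-- The defining relators of the universal algebra. Here `⟨α, J h⟩ x` is `⟨α, h⟩ J x`. -/
inductive Relator (ρ : Realization A H) : FreeQ n H → Prop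
  | hh (h h' : H) : Relator ρ ⁅hHat n h, hHat n h'⁆
  | he (h : H) (i : Fin n) : Relator ρ (⁅hHat n h, eHat H i⁆ - ρ.root i h • eHat H i)
  | hf (h : H) (i : Fin n) : Relator ρ (⁅hHat n h, fHat H i⁆ + ρ.root i h • fHat H i)
  | ef (i j : Fin n) :
      Relator ρ (⁅eHat H i, fHat H j⁆ - if i = j then hHat n (ρ.coroot i) else 0)
  | hJh (h h' : H) : Relator ρ ⁅hHat n h, freeJ n H (hHat n h')⁆
  | JhJh (h h' : H) : Relator ρ ⁅freeJ n H (hHat n h), freeJ n H (hHat n h')⁆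
  | Jhe (h : H) (i : Fin n) :
      Relator ρ (⁅freeJ n H (hHat n h), eHat H i⁆ - ρ.root i h • freeJ n H (eHat H i))
  | hJe (h : H) (i : Fin n) :
      Relator ρ (⁅hHat n h, freeJ n H (eHat H i)⁆ - ρ.root i h • freeJ n H (eHat H i))
  | JhJe (h : H) (i : Fin n) :
      Relator ρ (⁅freeJ n H (hHat n h), freeJ n H (eHat H i)⁆ + ρ.root i h • eHat H i)
  | Jhf (h : H) (i : Fin n) :
      Relator ρ (⁅freeJ n H (hHat n h), fHat H i⁆ + ρ.root i h • freeJ n H (fHat H i))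
  | hJf (h : H) (i : Fin n) :
      Relator ρ (⁅hHat n h, freeJ n H (fHat H i)⁆ + ρ.root i h • freeJ n H (fHat H i))
  | JhJf (h : H) (i : Fin n) :
      Relator ρ (⁅freeJ n H (hHat n h), freeJ n H (fHat H i)⁆ - ρ.root i h • fHat H i)
  | Jef (i j : Fin n) :
      Relator ρ (⁅freeJ n H (eHat H i), fHat H j⁆ -
        if i = j then freeJ n H (hHat n (ρ.coroot i)) else 0)
  | eJf (i j : Fin n) :
      Relator ρ (⁅eHat H i, freeJ n H (fHat H j)⁆ -
        if i = j then freeJ n H (hHat n (ρ.coroot i)) else 0)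
  | JeJf (i j : Fin n) :
      Relator ρ (⁅freeJ n H (eHat H i), freeJ n H (fHat H j)⁆ +
        if i = j then hHat n (ρ.coroot i) else 0)

/-- The ideal `Î` of `ĝ` generated by the relators. -/
def relIdeal (ρ : Realization A H) : LieIdeal ℂ (FreeQ n H) :=
  LieSubmodule.lieSpan ℂ (FreeQ n H) {x | Relator ρ x}

/-- The universal Kac-Moody quaternion Lie algebra `g̃(A) = ĝ / Î`. -/
def Univ (ρ : Realization A H) : Type _ := FreeQ n H ⧸ relIdeal ρ

instance (ρ : Realization A H) : LieRing (Univ ρ) :=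
  inferInstanceAs (LieRing (FreeQ n H ⧸ relIdeal ρ))
instance (ρ : Realization A H) : LieAlgebra ℂ (Univ ρ) :=
  inferInstanceAs (LieAlgebra ℂ (FreeQ n H ⧸ relIdeal ρ))

lemma freeJ_lie_right (x y : FreeQ n H) : ⁅x, freeJ n H y⁆ = freeJ n H ⁅x, y⁆ := by
  rw [← lie_skew, ← freeJ_lie, ← lie_skew x y, map_neg]

lemma freeJ_mem_relIdeal (ρ : Realization A H) {x : FreeQ n H} (hx : x ∈ relIdeal ρ) :
    freeJ n H x ∈ relIdeal ρ := by
  induction hx using LieSubmodule.lieSpan_induction with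
  | mem x hx =>
    have key : ∀ {z : FreeQ n H}, Relator ρ z → freeJ n H x = z → freeJ n H x ∈ relIdeal ρ :=
      fun hz h => h ▸ LieSubmodule.subset_lieSpan hz
    have key' : ∀ {z : FreeQ n H}, Relator ρ z → freeJ n H x = -z → freeJ n H x ∈ relIdeal ρ :=
      fun hz h => h ▸ neg_mem (LieSubmodule.subset_lieSpan hz)
    cases hx with
    | hh h h' => exact key (.hJh h h') (freeJ_lie_right _ _).symm
    | he h i => exact key (.Jhe h i) (by rw [map_sub, map_smul, freeJ_lie])
    | hf h i => exact key (.Jhf h i) (by rw [map_add, map_smul, freeJ_lie])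
    | ef i j => exact key (.Jef i j) (by rw [map_sub, freeJ_lie, apply_ite (freeJ n H), map_zero])
    | hJh h h' => exact key' (.hh h h') (by rw [freeJ_lie_right, freeJ_freeJ])
    | JhJh h h' => exact key' (.hJh h h') (by rw [freeJ_lie, freeJ_freeJ, neg_lie])
    | Jhe h i =>
      exact key' (.he h i) (by rw [map_sub, map_smul, freeJ_lie, freeJ_freeJ, freeJ_freeJ, neg_lie,
        smul_neg, neg_sub, sub_neg_eq_add, neg_add_eq_sub])
    | hJe h i =>
      exact key (.JhJe h i) (by rw [map_sub, map_smul, freeJ_lie, freeJ_freeJ, smul_neg,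
        sub_neg_eq_add])
    | JhJe h i =>
      exact key' (.hJe h i) (by rw [map_add, map_smul, freeJ_lie, freeJ_freeJ, neg_lie, neg_sub,
        neg_add_eq_sub])
    | Jhf h i =>
      exact key' (.hf h i) (by rw [map_add, map_smul, freeJ_lie, freeJ_freeJ, freeJ_freeJ, neg_lie,
        smul_neg, neg_add])
    | hJf h i =>
      exact key (.JhJf h i) (by rw [map_add, map_smul, freeJ_lie, freeJ_freeJ, smul_neg,
        sub_eq_add_neg])
    | JhJf h i =>
      exact key' (.hJf h i) (by rw [map_sub, map_smul, freeJ_lie, freeJ_freeJ, neg_lie, neg_add,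
        sub_eq_add_neg])
    | Jef i j =>
      refine key' (.ef i j) ?_
      rw [map_sub, freeJ_lie, freeJ_freeJ, apply_ite (freeJ n H), map_zero, freeJ_freeJ, neg_lie]
      split_ifs
      · rw [neg_sub, sub_neg_eq_add, neg_add_eq_sub]
      · rw [sub_zero, sub_zero]
    | eJf i j =>
      refine key (.JeJf i j) ?_
      rw [map_sub, freeJ_lie, apply_ite (freeJ n H), map_zero, freeJ_freeJ]
      split_ifs
      · rw [sub_neg_eq_add]
      · rw [sub_zero, add_zero]
    | JeJf i j =>
      refine key' (.eJf i j) ?_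
      rw [map_add, freeJ_lie, freeJ_freeJ, apply_ite (freeJ n H), map_zero, neg_lie, neg_sub,
        neg_add_eq_sub]
  | zero => simp
  | smul a y _ hy => rw [map_smul]; exact (relIdeal ρ).smul_mem a hy
  | add y z _ _ hy hz => rw [map_add]; exact add_mem hy hz
  | lie y z _ hz => rw [← freeJ_lie_right]; exact LieSubmodule.lie_mem _ hz

/-- The canonical projection `ĝ → g̃(A)`. -/
def toUniv (ρ : Realization A H) : FreeQ n H →ₗ[ℂ] Univ ρ :=
  (LieSubmodule.Quotient.mk' (relIdeal ρ) : FreeQ n H →ₗ[ℂ] FreeQ n H ⧸ relIdeal ρ)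

/-- The operator `J` on `g̃(A)`. -/
def univJ (ρ : Realization A H) : Univ ρ →ₗ[ℂ] Univ ρ :=
  Submodule.mapQ (relIdeal ρ).toSubmodule (relIdeal ρ).toSubmodule (freeJ n H)
    fun _ hx => freeJ_mem_relIdeal ρ hx

lemma univJ_toUniv (ρ : Realization A H) (x : FreeQ n H) :
    univJ ρ (toUniv ρ x) = toUniv ρ (freeJ n H x) := rfl

lemma toUniv_lie (ρ : Realization A H) (x y : FreeQ n H) :
    toUniv ρ ⁅x, y⁆ = ⁅toUniv ρ x, toUniv ρ y⁆ := rfl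

lemma toUniv_surjective (ρ : Realization A H) : Function.Surjective (toUniv ρ) :=
  LieSubmodule.Quotient.surjective_mk' (relIdeal ρ)

lemma univJ_univJ (ρ : Realization A H) (x : Univ ρ) : univJ ρ (univJ ρ x) = -x := by
  obtain ⟨x, rfl⟩ := toUniv_surjective ρ x
  rw [univJ_toUniv, univJ_toUniv, freeJ_freeJ, map_neg]

lemma univJ_lie (ρ : Realization A H) (x y : Univ ρ) : univJ ρ ⁅x, y⁆ = ⁅univJ ρ x, y⁆ := by
  obtain ⟨x, rfl⟩ := toUniv_surjective ρ x
  obtain ⟨y, rfl⟩ := toUniv_surjective ρ y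
  rw [← toUniv_lie, univJ_toUniv, univJ_toUniv, freeJ_lie, toUniv_lie]

lemma univJ_lie_right (ρ : Realization A H) (x y : Univ ρ) :
    ⁅x, univJ ρ y⁆ = univJ ρ ⁅x, y⁆ := by
  rw [← lie_skew, ← univJ_lie, ← lie_skew x y, map_neg]

/-- `S⁺`: the elements `(ad ε_j)^(1 - A_ji) (ε_i)` for `i ≠ j`, with `ε_k = e_k` or `J e_k`. -/
def serrePlus (ρ : Realization A H) : Set (Univ ρ) :=
  {x | ∃ i j : Fin n, i ≠ j ∧
    ∃ εi ∈ ({toUniv ρ (eHat H i), univJ ρ (toUniv ρ (eHat H i))} : Set (Univ ρ)),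
    ∃ εj ∈ ({toUniv ρ (eHat H j), univJ ρ (toUniv ρ (eHat H j))} : Set (Univ ρ)),
      x = (LieAlgebra.ad ℂ (Univ ρ) εj ^ (1 - A j i).toNat) εi}

/-- `S⁻`: the elements `(ad φ_j)^(1 - A_ji) (φ_i)` for `i ≠ j`, with `φ_k = f_k` or `J f_k`. -/
def serreMinus (ρ : Realization A H) : Set (Univ ρ) :=
  {x | ∃ i j : Fin n, i ≠ j ∧
    ∃ φi ∈ ({toUniv ρ (fHat H i), univJ ρ (toUniv ρ (fHat H i))} : Set (Univ ρ)),
    ∃ φj ∈ ({toUniv ρ (fHat H j), univJ ρ (toUniv ρ (fHat H j))} : Set (Univ ρ)),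
      x = (LieAlgebra.ad ℂ (Univ ρ) φj ^ (1 - A j i).toNat) φi}

/-- The ideal `I⁺` generated by `S⁺`. -/
def idealPlus (ρ : Realization A H) : LieIdeal ℂ (Univ ρ) :=
  LieSubmodule.lieSpan ℂ (Univ ρ) (serrePlus ρ)

/-- The ideal `I⁻` generated by `S⁻`. -/
def idealMinus (ρ : Realization A H) : LieIdeal ℂ (Univ ρ) :=
  LieSubmodule.lieSpan ℂ (Univ ρ) (serreMinus ρ)

/-- The ideal `I⁺ + I⁻`. -/
def serreIdeal (ρ : Realization A H) : LieIdeal ℂ (Univ ρ) := idealPlus ρ ⊔ idealMinus ρ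

/-- The standard Kac-Moody quaternion Lie algebra `g(A) = g̃(A) / (I⁺ + I⁻)`. -/
def Std (ρ : Realization A H) : Type _ := Univ ρ ⧸ serreIdeal ρ

instance (ρ : Realization A H) : LieRing (Std ρ) :=
  inferInstanceAs (LieRing (Univ ρ ⧸ serreIdeal ρ))
instance (ρ : Realization A H) : LieAlgebra ℂ (Std ρ) :=
  inferInstanceAs (LieAlgebra ℂ (Univ ρ ⧸ serreIdeal ρ))

lemma univJ_mem_lieSpan (ρ : Realization A H) {S : Set (Univ ρ)}
    (hS : ∀ x ∈ S, univJ ρ x ∈ LieSubmodule.lieSpan ℂ (Univ ρ) S) {x : Univ ρ}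
    (hx : x ∈ LieSubmodule.lieSpan ℂ (Univ ρ) S) :
    univJ ρ x ∈ LieSubmodule.lieSpan ℂ (Univ ρ) S := by
  induction hx using LieSubmodule.lieSpan_induction with
  | mem x hx => exact hS x hx
  | zero => simp
  | smul a y _ hy => rw [map_smul]; exact (LieSubmodule.lieSpan ℂ (Univ ρ) S).smul_mem a hy
  | add y z _ _ hy hz => rw [map_add]; exact add_mem hy hz
  | lie y z _ hz => rw [← univJ_lie_right]; exact LieSubmodule.lie_mem _ hz

lemma univJ_ad_pow (ρ : Realization A H) (x y : Univ ρ) (m : ℕ) :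
    univJ ρ ((LieAlgebra.ad ℂ (Univ ρ) x ^ m) y) =
      (LieAlgebra.ad ℂ (Univ ρ) x ^ m) (univJ ρ y) := by
  induction m with
  | zero => simp
  | succ m ih =>
    rw [pow_succ', Module.End.mul_apply, Module.End.mul_apply, LieAlgebra.ad_apply,
      LieAlgebra.ad_apply, ← univJ_lie_right, ih]

lemma univJ_mem_serreIdeal (ρ : Realization A H) {x : Univ ρ} (hx : x ∈ serreIdeal ρ) :
    univJ ρ x ∈ serreIdeal ρ := by
  obtain ⟨y, hy, z, hz, rfl⟩ := (LieSubmodule.mem_sup _ _ _).1 hx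
  rw [map_add]
  refine (LieSubmodule.mem_sup _ _ _).2 ⟨_, ?_, _, ?_, rfl⟩
  · refine univJ_mem_lieSpan ρ ?_ hy
    rintro _ ⟨i, j, hij, εi, hi, εj, hj, rfl⟩
    rw [univJ_ad_pow]
    rcases hi with rfl | rfl
    · exact LieSubmodule.subset_lieSpan ⟨i, j, hij, _, Or.inr rfl, εj, hj, rfl⟩
    · rw [univJ_univJ, map_neg]
      exact neg_mem (LieSubmodule.subset_lieSpan ⟨i, j, hij, _, Or.inl rfl, εj, hj, rfl⟩)
  · refine univJ_mem_lieSpan ρ ?_ hz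
    rintro _ ⟨i, j, hij, εi, hi, εj, hj, rfl⟩
    rw [univJ_ad_pow]
    rcases hi with rfl | rfl
    · exact LieSubmodule.subset_lieSpan ⟨i, j, hij, _, Or.inr rfl, εj, hj, rfl⟩
    · rw [univJ_univJ, map_neg]
      exact neg_mem (LieSubmodule.subset_lieSpan ⟨i, j, hij, _, Or.inl rfl, εj, hj, rfl⟩)

/-- The canonical projection `g̃(A) → g(A)`. -/
def toStd (ρ : Realization A H) : Univ ρ →ₗ[ℂ] Std ρ :=
  (LieSubmodule.Quotient.mk' (serreIdeal ρ) : Univ ρ →ₗ[ℂ] Univ ρ ⧸ serreIdeal ρ)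

end Universal

section Standard

variable {n : ℕ} {A : Matrix (Fin n) (Fin n) ℤ} {H : Type*} [AddCommGroup H] [Module ℂ H]

/-- The operator `J` on `g(A)`. -/
def J (ρ : Realization A H) : Std ρ →ₗ[ℂ] Std ρ :=
  Submodule.mapQ (serreIdeal ρ).toSubmodule (serreIdeal ρ).toSubmodule (univJ ρ)
    fun _ hx => univJ_mem_serreIdeal ρ hx

lemma toStd_surjective (ρ : Realization A H) : Function.Surjective (toStd ρ) :=
  LieSubmodule.Quotient.surjective_mk' (serreIdeal ρ)

lemma J_J (ρ : Realization A H) (x : Std ρ) : J ρ (J ρ x) = -x := by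
  obtain ⟨x, rfl⟩ := toStd_surjective ρ x
  change toStd ρ (univJ ρ (univJ ρ x)) = _
  rw [univJ_univJ, map_neg]

lemma J_lie (ρ : Realization A H) (x y : Std ρ) : J ρ ⁅x, y⁆ = ⁅J ρ x, y⁆ := by
  obtain ⟨x, rfl⟩ := toStd_surjective ρ x
  obtain ⟨y, rfl⟩ := toStd_surjective ρ y
  change toStd ρ (univJ ρ ⁅x, y⁆) = toStd ρ ⁅univJ ρ x, y⁆
  rw [univJ_lie]

/-- The generators `e_i` of `g(A)`. -/
def e (ρ : Realization A H) (i : Fin n) : Std ρ := toStd ρ (toUniv ρ (eHat H i))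

/-- The generators `f_i` of `g(A)`. -/
def f (ρ : Realization A H) (i : Fin n) : Std ρ := toStd ρ (toUniv ρ (fHat H i))

/-- The canonical map `H → g(A)`. -/
def hMap (ρ : Realization A H) : H →ₗ[ℂ] Std ρ :=
  toStd ρ ∘ₗ toUniv ρ ∘ₗ freeGen n H ∘ₗ
    LinearMap.inr ℂ (Fin n → ℂ) ((Fin n → ℂ) × H) ∘ₗ LinearMap.inr ℂ (Fin n → ℂ) H

/-- The canonical map `(h, h') ↦ h + J h'` from `H ⊕ J H` to `g(A)`. -/
def cartanMap (ρ : Realization A H) : H × H →ₗ[ℂ] Std ρ :=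
  (hMap ρ).coprod (J ρ ∘ₗ hMap ρ)

/-- `N⁺`, generated by the `e_i` and `J e_i`. -/
def nPlus (ρ : Realization A H) : LieSubalgebra ℂ (Std ρ) :=
  LieSubalgebra.lieSpan ℂ (Std ρ) (Set.range (e ρ) ∪ Set.range fun i => J ρ (e ρ i))

/-- `N⁻`, generated by the `f_i` and `J f_i`. -/
def nMinus (ρ : Realization A H) : LieSubalgebra ℂ (Std ρ) :=
  LieSubalgebra.lieSpan ℂ (Std ρ) (Set.range (f ρ) ∪ Set.range fun i => J ρ (f ρ i))

/-- `K`, generated by `H` and `J H`. -/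
def cartan (ρ : Realization A H) : LieSubalgebra ℂ (Std ρ) :=
  LieSubalgebra.lieSpan ℂ (Std ρ) (Set.range (hMap ρ) ∪ Set.range fun h => J ρ (hMap ρ h))

/-- `Q⁺`: the combinations of simple roots with natural number coefficients. -/
def qPlus (ρ : Realization A H) : AddSubmonoid (Module.Dual ℂ H) :=
  AddSubmonoid.closure (Set.range ρ.root)

/-- The root space `g_α = {x | ad h (x) = ⟨α, h⟩ x for all h ∈ Hr}`, where `Hr` is a real
subspace of `H`, such as a real form or `H` itself. -/
def rootSpace (ρ : Realization A H) (Hr : Submodule ℝ H) (α : Module.Dual ℂ H) :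
    Submodule ℂ (Std ρ) where
  carrier := {x | ∀ h ∈ Hr, ⁅hMap ρ h, x⁆ = α h • x}
  add_mem' hx hy h hh := by rw [lie_add, hx h hh, hy h hh, smul_add]
  zero_mem' h _ := by simp
  smul_mem' a x hx h hh := by rw [lie_smul, hx h hh, smul_comm]

end Standard

end QuatKacMoody

end

open QuatKacMoody

/-! Since `J` is complex linear, has square -1 and satisfies `[Jx, y] = [x, Jy] = J[x, y]`, it acts
as an extra scalar. The classical argument for Kac–Moody algebras therefore runs over the
commutative ring ℂ[J], and only the relations without `J` need to be verified. `ChevalleyData`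
isolates what is used, so that g̃(A) and g(A) are treated together; `swap` exchanges the roles of
`e` and `f`, so one half of each argument suffices.

The span of f-words, H + JH and e-words is stable under all generators, hence is everything
(`neg_sup_zero_sup_pos`). An element of H on which every simple root takes the value 1
(`exists_height`) gives these three pieces negative, zero and positive height. Joint eigenspaces of
commuting operators are independent, so the sum is direct (`iSupIndep_triangular`) and the weight
spaces are exactly the evident spans of words (`wt_eq`). Finite dimensionality and g_0 = K follow.

What remains is that H × H does not collapse. In g̃(A) this is detected by Verma modules: for every
μ in the dual of H the generators act on the space of words in the letters f_i, and tensoring the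
endomorphism ring with ℍ accommodates `J`. The empty word reads off μ(h) and μ(h') from h + Jh', and
μ is arbitrary (`univData_cartanHom_injective`). To pass to g(A), an sl₂ computation shows that
Serre elements in the `e i` are killed by every ad f_k (`lie_f_serre`), so the ideal they generate
stays inside the positive part (`lieSpan_serreSet_le_pos`). By symmetry I⁺ + I⁻ lies in the sum of
the positive and negative parts, so it meets H + JH only in 0 (`cartanMap_injective`). -/

namespace QuatKacMoody

/-! ### Chevalley generators with an operator `J`, and the symmetry between `e` and `f`. -/

/-- A complex Lie algebra with an operator `J`, generated together with `J` by elements `e i`, `f i`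
and `h a` that satisfy the Chevalley relations of a realization. -/
structure ChevalleyData {n : ℕ} {A : Matrix (Fin n) (Fin n) ℤ} {H : Type*} [AddCommGroup H]
    [Module ℂ H] (ρ : Realization A H) (L : Type*) [LieRing L] [LieAlgebra ℂ L] where
  J : L →ₗ[ℂ] L
  e : Fin n → L
  f : Fin n → L
  h : H →ₗ[ℂ] L
  J_J : ∀ x, J (J x) = -x
  J_lie : ∀ x y, ⁅J x, y⁆ = J ⁅x, y⁆
  lie_h_h : ∀ a b, ⁅h a, h b⁆ = 0
  lie_h_e : ∀ a i, ⁅h a, e i⁆ = ρ.root i a • e i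
  lie_h_f : ∀ a i, ⁅h a, f i⁆ = -(ρ.root i a • f i)
  lie_e_f : ∀ i j, ⁅e i, f j⁆ = if i = j then h (ρ.coroot i) else 0
  gen : ∀ S : LieSubalgebra ℂ L, (∀ x ∈ S, J x ∈ S) → (∀ i, e i ∈ S) → (∀ i, f i ∈ S) →
    (∀ a, h a ∈ S) → S = ⊤

namespace ChevalleyData

variable {n : ℕ} {A : Matrix (Fin n) (Fin n) ℤ} {H : Type*} [AddCommGroup H] [Module ℂ H]
  {ρ : Realization A H} {L : Type*} [LieRing L] [LieAlgebra ℂ L] (D : ChevalleyData ρ L)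

/-- The Chevalley involution on presentations. -/
@[simps]
def swap : ChevalleyData ρ L where
  J := D.J
  e := D.f
  f := D.e
  h := -D.h
  J_J := D.J_J
  J_lie := D.J_lie
  lie_h_h a b := by simp [D.lie_h_h]
  lie_h_e a i := by simp [D.lie_h_f]
  lie_h_f a i := by simp [D.lie_h_e]
  lie_e_f i j := by
    rw [← lie_skew, D.lie_e_f]
    by_cases hij : i = j
    · subst hij; simp
    · simp [hij, Ne.symm hij]
  gen S hJ he hf hh := D.gen S hJ hf he fun a => by simpa using hh a

lemma swap_swap : D.swap.swap = D := by
  cases D; simp [swap]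

lemma lie_J (x y : L) : ⁅x, D.J y⁆ = D.J ⁅x, y⁆ := by
  rw [← lie_skew, D.J_lie, ← lie_skew x y, map_neg]

lemma lie_f_e (i j : Fin n) : ⁅D.f i, D.e j⁆ = -if j = i then D.h (ρ.coroot j) else 0 := by
  rw [← lie_skew, D.lie_e_f]

/-- A subspace stable under the generators is stable under the whole Lie algebra. -/
lemma lie_mem_of_stable {W : Submodule ℂ L} (hJ : ∀ x ∈ W, D.J x ∈ W)
    (he : ∀ i, ∀ x ∈ W, ⁅D.e i, x⁆ ∈ W) (hf : ∀ i, ∀ x ∈ W, ⁅D.f i, x⁆ ∈ W)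
    (hh : ∀ a, ∀ x ∈ W, ⁅D.h a, x⁆ ∈ W) (x : L) {y : L} (hy : y ∈ W) : ⁅x, y⁆ ∈ W := by
  -- By the Jacobi identity, the elements whose adjoint action preserves `W` form a subalgebra;
  -- `J`-stability of `W` makes it `J`-stable, so it is everything once it contains the generators.
  let S : LieSubalgebra ℂ L :=
    { carrier := {x | ∀ y ∈ W, ⁅x, y⁆ ∈ W}
      add_mem' := fun ha hb y hy => by rw [add_lie]; exact add_mem (ha y hy) (hb y hy)
      zero_mem' := fun y _ => by simp
      smul_mem' := fun c x hx y hy => by rw [smul_lie]; exact W.smul_mem c (hx y hy)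
      lie_mem' := fun ha hb y hy => by
        rw [lie_lie]; exact sub_mem (ha _ (hb y hy)) (hb _ (ha y hy)) }
  have hS : S = ⊤ := D.gen S (fun x hx y hy => by rw [D.J_lie]; exact hJ _ (hx y hy)) he hf hh
  exact (hS ▸ LieSubalgebra.mem_top x : x ∈ S) y hy

/-! ### Weight spaces. -/

/-- The simultaneous eigenspace of the `ad (h a)` with eigenvalues `α a`. -/
def wt (α : Module.Dual ℂ H) : Submodule ℂ L where
  carrier := {x | ∀ a, ⁅D.h a, x⁆ = α a • x}
  add_mem' hx hy a := by rw [lie_add, hx a, hy a, smul_add]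
  zero_mem' a := by simp
  smul_mem' c x hx a := by rw [lie_smul, hx a, smul_comm]

lemma mem_wt {α : Module.Dual ℂ H} {x : L} : x ∈ D.wt α ↔ ∀ a, ⁅D.h a, x⁆ = α a • x := Iff.rfl

lemma J_mem_wt {α : Module.Dual ℂ H} {x : L} (hx : x ∈ D.wt α) : D.J x ∈ D.wt α := fun a => by
  rw [D.lie_J, hx a, map_smul]

lemma h_mem_wt (a : H) : D.h a ∈ D.wt 0 := fun b => by simp [D.lie_h_h]

lemma e_mem_wt (i : Fin n) : D.e i ∈ D.wt (ρ.root i) := fun a => D.lie_h_e a i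

lemma lie_mem_wt {α β : Module.Dual ℂ H} {x y : L} (hx : x ∈ D.wt α) (hy : y ∈ D.wt β) :
    ⁅x, y⁆ ∈ D.wt (α + β) := fun a => by
  rw [leibniz_lie, hx a, hy a, smul_lie, lie_smul, LinearMap.add_apply, add_smul]

lemma swap_wt (α : Module.Dual ℂ H) : D.swap.wt α = D.wt (-α) := by
  ext x
  simp only [mem_wt, swap_h, LinearMap.neg_apply, neg_lie, neg_eq_iff_eq_neg, neg_smul]

/-- The operators `ad (h a)` commute, so their joint generalized eigenspaces, indexed by arbitrary
functions on `H`, are independent. Weight spaces sit inside those indexed by linear functionals. -/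
lemma iSupIndep_wt : iSupIndep D.wt := by
  have key := Module.End.independent_iInf_maxGenEigenspace_of_forall_mapsTo
    (fun a : H => LieAlgebra.ad ℂ L (D.h a)) fun a b φ =>
      Module.End.mapsTo_maxGenEigenspace_of_comm (by
        refine LinearMap.ext fun x => ?_
        simp only [Module.End.mul_apply, LieAlgebra.ad_apply]
        rw [leibniz_lie, D.lie_h_h, zero_lie, zero_add]) φ
  refine (key.comp (f := fun α : Module.Dual ℂ H => (α : H → ℂ)) DFunLike.coe_injective).mono ?_
  intro α x hx
  simp only [Function.comp, Submodule.mem_iInf]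
  intro a
  have : x ∈ Module.End.eigenspace (LieAlgebra.ad ℂ L (D.h a)) (α a) := by
    rw [Module.End.mem_eigenspace_iff]; exact hx a
  exact (Module.End.genEigenspace_le_maximal (LieAlgebra.ad ℂ L (D.h a)) (α a) 1) this

/-! ### Spans of e-words applied to weight vectors. -/

/-- The operator `ad e_{i₁} ⋯ ad e_{iₖ}` attached to the word `i₁ ⋯ iₖ`. -/
def adWord (w : List (Fin n)) (x : L) : L := w.foldr (fun i y => ⁅D.e i, y⁆) x

@[simp] lemma adWord_nil (x : L) : D.adWord [] x = x := rfl

@[simp] lemma adWord_cons (i : Fin n) (w : List (Fin n)) (x : L) :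
    D.adWord (i :: w) x = ⁅D.e i, D.adWord w x⁆ := rfl

/-- The sum of the simple roots occurring in a word. -/
def _root_.QuatKacMoody.Realization.wordRoot (ρ : Realization A H) (w : List (Fin n)) :
    Module.Dual ℂ H := (w.map ρ.root).sum

lemma _root_.QuatKacMoody.Realization.wordRoot_cons (i : Fin n) (w : List (Fin n)) :
    ρ.wordRoot (i :: w) = ρ.root i + ρ.wordRoot w := by simp [Realization.wordRoot]

lemma adWord_mem_wt (w : List (Fin n)) {β : Module.Dual ℂ H} {x : L} (hx : x ∈ D.wt β) :
    D.adWord w x ∈ D.wt (ρ.wordRoot w + β) := by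
  induction w with
  | nil => simpa [Realization.wordRoot] using hx
  | cons i w ih =>
    rw [Realization.wordRoot_cons, add_assoc]
    exact D.lie_mem_wt (D.e_mem_wt i) ih

/-- The smallest `J`-stable subspace containing `X` and stable under the `ad (e i)`. -/
def wordSpan (X : Set L) : Submodule ℂ L :=
  Submodule.span ℂ {y | ∃ w, ∃ x ∈ X, y = D.adWord w x ∨ y = D.J (D.adWord w x)}

variable {X : Set L}

lemma adWord_mem_wordSpan (w : List (Fin n)) {x : L} (hx : x ∈ X) :
    D.adWord w x ∈ D.wordSpan X :=
  Submodule.subset_span ⟨w, x, hx, Or.inl rfl⟩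

lemma subset_wordSpan {x : L} (hx : x ∈ X) : x ∈ D.wordSpan X := D.adWord_mem_wordSpan [] hx

lemma J_mem_wordSpan {x : L} (hx : x ∈ D.wordSpan X) : D.J x ∈ D.wordSpan X := by
  induction hx using Submodule.span_induction with
  | mem y hy =>
    obtain ⟨w, x, hx, rfl | rfl⟩ := hy
    · exact Submodule.subset_span ⟨w, x, hx, Or.inr rfl⟩
    · rw [D.J_J]
      exact neg_mem (D.adWord_mem_wordSpan w hx)
  | zero => simp
  | add y z _ _ hy hz => rw [map_add]; exact add_mem hy hz
  | smul c y _ hy => rw [map_smul]; exact Submodule.smul_mem _ c hy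

lemma wordSpan_le {V : Submodule ℂ L} (hJ : ∀ x ∈ V, D.J x ∈ V)
    (hw : ∀ w, ∀ x ∈ X, D.adWord w x ∈ V) : D.wordSpan X ≤ V := by
  refine Submodule.span_le.2 ?_
  rintro _ ⟨w, x, hx, rfl | rfl⟩
  · exact hw w x hx
  · exact hJ _ (hw w x hx)

lemma wordSpan_le_of_stable {V : Submodule ℂ L} (hJ : ∀ x ∈ V, D.J x ∈ V)
    (he : ∀ i, ∀ x ∈ V, ⁅D.e i, x⁆ ∈ V) (hX : ∀ x ∈ X, x ∈ V) : D.wordSpan X ≤ V := by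
  refine D.wordSpan_le hJ fun w x hx => ?_
  induction w with
  | nil => exact hX x hx
  | cons i w ih => exact he i _ ih

lemma lie_mem_of_forall_adWord {V : Submodule ℂ L} (hJ : ∀ x ∈ V, D.J x ∈ V) {z : L}
    (hw : ∀ w, ∀ x ∈ X, ⁅z, D.adWord w x⁆ ∈ V) {y : L} (hy : y ∈ D.wordSpan X) : ⁅z, y⁆ ∈ V :=
  (D.wordSpan_le (V := V.comap (LieAlgebra.ad ℂ L z : L →ₗ[ℂ] L))
    (fun x hx => by
      rw [Submodule.mem_comap] at hx ⊢
      simpa [D.lie_J] using hJ _ hx) hw) hy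

lemma lie_e_mem_wordSpan (i : Fin n) {x : L} (hx : x ∈ D.wordSpan X) :
    ⁅D.e i, x⁆ ∈ D.wordSpan X :=
  D.lie_mem_of_forall_adWord (fun _ => D.J_mem_wordSpan)
    (fun w _ hx => D.adWord_mem_wordSpan (i :: w) hx) hx

lemma lie_h_mem_wordSpan (hX : ∀ x ∈ X, ∃ β, x ∈ D.wt β) (a : H) {x : L}
    (hx : x ∈ D.wordSpan X) : ⁅D.h a, x⁆ ∈ D.wordSpan X := by
  refine D.lie_mem_of_forall_adWord (fun _ => D.J_mem_wordSpan) (fun w x hx => ?_) hx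
  obtain ⟨β, hβ⟩ := hX x hx
  rw [D.adWord_mem_wt w hβ a]
  exact Submodule.smul_mem _ _ (D.adWord_mem_wordSpan w hx)

/-- Moving `f k` past each letter costs only a term in `h`, which acts on a word by a scalar. The
target `V` may exceed the word span because `f k` can throw the elements of `X` themselves out of
it, as happens for `X` the set of the `e i`. -/
lemma lie_f_mem_of_wordSpan (hX : ∀ x ∈ X, ∃ β, x ∈ D.wt β) {V : Submodule ℂ L}
    (hJ : ∀ x ∈ V, D.J x ∈ V) (he : ∀ i, ∀ x ∈ V, ⁅D.e i, x⁆ ∈ V) (hV : D.wordSpan X ≤ V)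
    (k : Fin n) (hf : ∀ x ∈ X, ⁅D.f k, x⁆ ∈ V) {x : L} (hx : x ∈ D.wordSpan X) :
    ⁅D.f k, x⁆ ∈ V := by
  refine D.lie_mem_of_forall_adWord hJ (fun w x hx => ?_) hx
  induction w with
  | nil => exact hf x hx
  | cons i w ih =>
    rw [adWord_cons, leibniz_lie, D.lie_f_e]
    refine add_mem ?_ (he i _ ih)
    split_ifs
    · rw [neg_lie]
      exact neg_mem (hV (D.lie_h_mem_wordSpan hX _ (D.adWord_mem_wordSpan w hx)))
    · simp

/-- If weight vectors are killed by the `ad (f k)`, then the ideal they generate is spanned by the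
words in the `e i` applied to them. -/
lemma lieSpan_le_wordSpan (hX : ∀ x ∈ X, ∃ β, x ∈ D.wt β) (hf : ∀ k, ∀ x ∈ X, ⁅D.f k, x⁆ = 0)
    {Y : Set L} (hY : ∀ y ∈ Y, y ∈ D.wordSpan X) :
    (LieSubmodule.lieSpan ℂ L Y).toSubmodule ≤ D.wordSpan X := by
  let I : LieIdeal ℂ L :=
    { D.wordSpan X with
      lie_mem := fun {x y} hy => D.lie_mem_of_stable (W := D.wordSpan X)
        (fun _ => D.J_mem_wordSpan) (fun i _ => D.lie_e_mem_wordSpan i)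
        (fun k _ => D.lie_f_mem_of_wordSpan hX (fun _ => D.J_mem_wordSpan)
          (fun i _ => D.lie_e_mem_wordSpan i) le_rfl k fun x hx => by
            rw [hf k x hx]; exact zero_mem _)
        (fun a _ => D.lie_h_mem_wordSpan hX a) x hy }
  exact LieSubmodule.lieSpan_le (N := I) |>.2 hY

/-! ### The triangular decomposition as a sum, and the subalgebras it consists of. -/

/-- The span of the `e`-words and their images under `J`. -/
def pos : Submodule ℂ L := D.wordSpan (Set.range D.e)

/-- The span of the `f`-words and their images under `J`. -/
def neg : Submodule ℂ L := D.swap.pos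

/-- The map `(a, b) ↦ h a + J (h b)`. -/
def cartanHom : H × H →ₗ[ℂ] L := D.h.coprod (D.J ∘ₗ D.h)

lemma cartanHom_apply (p : H × H) : D.cartanHom p = D.h p.1 + D.J (D.h p.2) := rfl

/-- The subspace `H + J H`. -/
def zero : Submodule ℂ L := LinearMap.range D.cartanHom

lemma swap_neg : D.swap.neg = D.pos := by rw [neg, swap_swap]

lemma h_mem_zero (a : H) : D.h a ∈ D.zero := ⟨(a, 0), by simp [cartanHom_apply]⟩

lemma J_mem_zero {x : L} (hx : x ∈ D.zero) : D.J x ∈ D.zero := by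
  obtain ⟨p, rfl⟩ := hx
  exact ⟨(-p.2, p.1), by simp [cartanHom_apply, D.J_J, add_comm]⟩

lemma swap_zero : D.swap.zero = D.zero := by
  have : D.swap.cartanHom = -D.cartanHom := by
    ext p <;> simp [cartanHom_apply]
  rw [zero, this, LinearMap.range_neg, zero]

lemma zero_le_wt : D.zero ≤ D.wt 0 := by
  rintro _ ⟨p, rfl⟩
  exact add_mem (D.h_mem_wt _) (D.J_mem_wt (D.h_mem_wt _))

lemma e_mem_pos (i : Fin n) : D.e i ∈ D.pos := D.subset_wordSpan ⟨i, rfl⟩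

lemma J_mem_pos {x : L} (hx : x ∈ D.pos) : D.J x ∈ D.pos := D.J_mem_wordSpan hx

lemma exists_mem_wt_of_mem_range_e : ∀ x ∈ Set.range D.e, ∃ β, x ∈ D.wt β := by
  rintro _ ⟨i, rfl⟩
  exact ⟨_, D.e_mem_wt i⟩

lemma lie_e_mem_of_mem_zero (i : Fin n) {x : L} (hx : x ∈ D.zero) : ⁅D.e i, x⁆ ∈ D.pos := by
  obtain ⟨p, rfl⟩ := hx
  have key (a : H) : ⁅D.e i, D.h a⁆ ∈ D.pos := by
    rw [← lie_skew, D.lie_h_e]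
    exact neg_mem (Submodule.smul_mem _ _ (D.e_mem_pos i))
  rw [cartanHom_apply, lie_add, D.lie_J]
  exact add_mem (key _) (D.J_mem_pos (key _))

lemma lie_h_mem_pos (a : H) {x : L} (hx : x ∈ D.pos) : ⁅D.h a, x⁆ ∈ D.pos :=
  D.lie_h_mem_wordSpan D.exists_mem_wt_of_mem_range_e a hx

/-- Only on a single letter does `f k` produce an element of `H`; any further `ad (e i)` brings it
back to `pos`. -/
lemma lie_f_mem_of_mem_pos (k : Fin n) {x : L} (hx : x ∈ D.pos) :
    ⁅D.f k, x⁆ ∈ D.zero ⊔ D.pos := by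
  refine D.lie_f_mem_of_wordSpan D.exists_mem_wt_of_mem_range_e (fun x hx => ?_)
    (fun i x hx => ?_) le_sup_right k ?_ hx
  · obtain ⟨y, hy, z, hz, rfl⟩ := Submodule.mem_sup.1 hx
    rw [map_add]
    exact Submodule.add_mem_sup (D.J_mem_zero hy) (D.J_mem_pos hz)
  · obtain ⟨y, hy, z, hz, rfl⟩ := Submodule.mem_sup.1 hx
    rw [lie_add]
    exact Submodule.mem_sup_right
      (add_mem (D.lie_e_mem_of_mem_zero i hy) (D.lie_e_mem_wordSpan i hz))
  · rintro _ ⟨i, rfl⟩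
    rw [D.lie_f_e]
    refine Submodule.mem_sup_left (neg_mem ?_)
    split_ifs
    · exact D.h_mem_zero _
    · exact zero_mem _

lemma lie_e_mem_triangular (i : Fin n) {x : L} (hx : x ∈ D.neg ⊔ (D.zero ⊔ D.pos)) :
    ⁅D.e i, x⁆ ∈ D.neg ⊔ (D.zero ⊔ D.pos) := by
  obtain ⟨x, hx', _, h', rfl⟩ := Submodule.mem_sup.1 hx
  obtain ⟨y, hy, z, hz, rfl⟩ := Submodule.mem_sup.1 h'
  rw [lie_add, lie_add]
  refine add_mem ?_ (Submodule.mem_sup_right (Submodule.mem_sup_right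
    (add_mem (D.lie_e_mem_of_mem_zero i hy) (D.lie_e_mem_wordSpan i hz))))
  -- For the swapped data, `D.e i` plays the role of `f i` and `neg` that of `pos`.
  have := D.swap.lie_f_mem_of_mem_pos i hx'
  rw [swap_zero] at this
  exact (sup_le (le_sup_left.trans le_sup_right) le_sup_left :
    D.zero ⊔ D.swap.pos ≤ D.neg ⊔ (D.zero ⊔ D.pos)) this

/-- The left side is stable under `J` and under the adjoint action of every generator, hence under
that of all of `L`. It is thus a `J`-stable subalgebra containing the generators. The `f`-half of
the stability is the `e`-half for `swap`. -/
lemma neg_sup_zero_sup_pos : D.neg ⊔ (D.zero ⊔ D.pos) = ⊤ := by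
  set T := D.neg ⊔ (D.zero ⊔ D.pos) with hT
  have hJ : ∀ x ∈ T, D.J x ∈ T := fun x hx => by
    obtain ⟨x, hx', _, h', rfl⟩ := Submodule.mem_sup.1 hx
    obtain ⟨y, hy, z, hz, rfl⟩ := Submodule.mem_sup.1 h'
    rw [map_add, map_add]
    exact Submodule.add_mem_sup (D.swap.J_mem_pos hx')
      (Submodule.add_mem_sup (D.J_mem_zero hy) (D.J_mem_pos hz))
  have hswap : T = D.swap.neg ⊔ (D.swap.zero ⊔ D.swap.pos) := by
    rw [swap_neg, swap_zero, hT, ← neg, sup_comm D.neg, sup_comm D.zero, sup_assoc]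
  have hstable : ∀ x, ∀ y ∈ T, ⁅x, y⁆ ∈ T := fun x y hy =>
    D.lie_mem_of_stable hJ (fun i _ => D.lie_e_mem_triangular i)
      (fun i y hy => by
        rw [hswap] at hy ⊢
        exact D.swap.lie_e_mem_triangular i hy)
      (fun a y hy => by
        obtain ⟨x, hx', _, h', rfl⟩ := Submodule.mem_sup.1 hy
        obtain ⟨y, hy', z, hz, rfl⟩ := Submodule.mem_sup.1 h'
        rw [lie_add, lie_add, D.zero_le_wt hy' a, LinearMap.zero_apply, zero_smul, zero_add]
        refine Submodule.add_mem_sup ?_ (Submodule.mem_sup_right (D.lie_h_mem_pos a hz))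
        simpa [neg] using D.swap.lie_h_mem_pos (-a) hx') x hy
  let S : LieSubalgebra ℂ L := { T with lie_mem' := fun {x y} _ hy => hstable x y hy }
  have hS : S = ⊤ := D.gen S hJ
    (fun i => Submodule.mem_sup_right (Submodule.mem_sup_right (D.e_mem_pos i)))
    (fun i => Submodule.mem_sup_left (D.swap.e_mem_pos i))
    (fun a => Submodule.mem_sup_right (Submodule.mem_sup_left (D.h_mem_zero a)))
  exact eq_top_iff.2 fun x _ => (hS ▸ LieSubalgebra.mem_top x : x ∈ S)

/-- The point is that iterated brackets with arbitrary bracketing reduce to right-nested words. The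
induction carries the extra claim that `ad x` preserves `pos`, which survives brackets by the Jacobi
identity. -/
lemma toSubmodule_lieSpan_e :
    (LieSubalgebra.lieSpan ℂ L (Set.range D.e ∪ Set.range fun i => D.J (D.e i))).toSubmodule =
      D.pos := by
  set P := LieSubalgebra.lieSpan ℂ L (Set.range D.e ∪ Set.range fun i => D.J (D.e i))
  have hPe (i : Fin n) : D.e i ∈ P := LieSubalgebra.subset_lieSpan (Or.inl ⟨i, rfl⟩)
  have hPJe (i : Fin n) : D.J (D.e i) ∈ P := LieSubalgebra.subset_lieSpan (Or.inr ⟨i, rfl⟩)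
  have hPJ : ∀ x ∈ P, D.J x ∈ P := fun x hx => by
    induction hx using LieSubalgebra.lieSpan_induction with
    | mem y hy =>
      obtain ⟨i, rfl⟩ | ⟨i, rfl⟩ := hy
      · exact hPJe i
      · simpa [D.J_J] using hPe i
    | zero => simp
    | add y z _ _ hy hz => rw [map_add]; exact add_mem hy hz
    | smul c y _ hy => rw [map_smul]; exact P.smul_mem c hy
    | lie y z hy hz hy' hz' => rw [← D.lie_J]; exact P.lie_mem hy hz'
  refine le_antisymm (fun x hx => ?_) ?_
  · have key : ∀ x ∈ P, x ∈ D.pos ∧ ∀ y ∈ D.pos, ⁅x, y⁆ ∈ D.pos := fun x hx => by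
      induction hx using LieSubalgebra.lieSpan_induction with
      | mem y hy =>
        obtain ⟨i, rfl⟩ | ⟨i, rfl⟩ := hy
        · exact ⟨D.e_mem_pos i, fun z hz => D.lie_e_mem_wordSpan i hz⟩
        · refine ⟨D.J_mem_pos (D.e_mem_pos i), fun z hz => ?_⟩
          simpa [D.J_lie] using D.J_mem_pos (D.lie_e_mem_wordSpan i hz)
      | zero => simp
      | add y z _ _ hy hz =>
        refine ⟨add_mem hy.1 hz.1, fun w hw => ?_⟩
        rw [add_lie]; exact add_mem (hy.2 w hw) (hz.2 w hw)
      | smul c y _ hy =>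
        refine ⟨Submodule.smul_mem _ c hy.1, fun w hw => ?_⟩
        rw [smul_lie]; exact Submodule.smul_mem _ c (hy.2 w hw)
      | lie y z _ _ hy hz =>
        refine ⟨hy.2 z hz.1, fun w hw => ?_⟩
        rw [lie_lie]; exact sub_mem (hy.2 _ (hz.2 w hw)) (hz.2 _ (hy.2 w hw))
    exact (key x hx).1
  · refine D.wordSpan_le_of_stable hPJ (fun i x hx => P.lie_mem (hPe i) hx) ?_
    rintro _ ⟨i, rfl⟩
    exact hPe i

lemma toSubmodule_lieSpan_h :
    (LieSubalgebra.lieSpan ℂ L (Set.range D.h ∪ Set.range fun a => D.J (D.h a))).toSubmodule =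
      D.zero := by
  set P := LieSubalgebra.lieSpan ℂ L (Set.range D.h ∪ Set.range fun a => D.J (D.h a))
  have hcomm : ∀ x ∈ D.zero, ∀ y ∈ D.zero, ⁅x, y⁆ = 0 := by
    rintro _ ⟨p, rfl⟩ _ ⟨q, rfl⟩
    simp [cartanHom_apply, D.lie_J, D.J_lie, D.lie_h_h]
  refine le_antisymm (fun x hx => ?_) ?_
  · have hx : x ∈ P := hx
    induction hx using LieSubalgebra.lieSpan_induction with
    | mem y hy =>
      obtain ⟨a, rfl⟩ | ⟨a, rfl⟩ := hy
      · exact D.h_mem_zero a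
      · exact D.J_mem_zero (D.h_mem_zero a)
    | zero => simp
    | add y z h1 h2 hy hz => exact add_mem (hy h1) (hz h2)
    | smul c y h1 hy => exact Submodule.smul_mem _ c (hy h1)
    | lie y z h1 h2 hy hz => rw [hcomm _ (hy h1) _ (hz h2)]; exact zero_mem _
  · rintro _ ⟨p, rfl⟩
    exact add_mem (LieSubalgebra.subset_lieSpan (Or.inl ⟨_, rfl⟩) : _ ∈ P)
      (LieSubalgebra.subset_lieSpan (Or.inr ⟨_, rfl⟩) : _ ∈ P)

end ChevalleyData

/-! ### The height of a root-lattice element. -/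

section Height

variable {n : ℕ} {A : Matrix (Fin n) (Fin n) ℤ} {H : Type*} [AddCommGroup H] [Module ℂ H]
  (ρ : Realization A H)

/-- Independence of the simple roots yields a functional on the dual with value 1 on each of them;
reflexivity of the finite-dimensional `H` makes it evaluation at a point. -/
lemma Realization.exists_height [FiniteDimensional ℂ H] : ∃ a : H, ∀ i, ρ.root i a = 1 := by
  obtain ⟨φ, hφ⟩ : ∃ φ : Module.Dual ℂ (Module.Dual ℂ H), ∀ i, φ (ρ.root i) = 1 := by
    obtain ⟨φ, hφ⟩ := LinearMap.exists_extend
      (Finsupp.linearCombination ℂ (fun _ : Fin n => (1 : ℂ)) ∘ₗ ρ.root_indep.repr)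
    refine ⟨φ, fun i => ?_⟩
    have hi : ρ.root i ∈ Submodule.span ℂ (Set.range ρ.root) := Submodule.subset_span ⟨i, rfl⟩
    have : φ (ρ.root i) = Finsupp.linearCombination ℂ (fun _ : Fin n => (1 : ℂ))
        (ρ.root_indep.repr ⟨ρ.root i, hi⟩) := LinearMap.congr_fun hφ ⟨ρ.root i, hi⟩
    rw [this, ρ.root_indep.repr_eq_single i _ rfl]
    simp
  refine ⟨(Module.evalEquiv ℂ H).symm φ, fun i => ?_⟩
  rw [← hφ i, Module.apply_evalEquiv_symm_apply]

variable {ρ}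

lemma Realization.wordRoot_apply {a : H} (ha : ∀ i, ρ.root i a = 1) (w : List (Fin n)) :
    ρ.wordRoot w a = w.length := by
  induction w with
  | nil => simp [Realization.wordRoot]
  | cons i w ih => simp [Realization.wordRoot_cons, ha, ih, add_comm]

lemma Realization.wordRoot_mem_qPlus (w : List (Fin n)) : ρ.wordRoot w ∈ qPlus ρ :=
  AddSubmonoid.list_sum_mem _ fun x hx => by
    obtain ⟨i, -, rfl⟩ := List.mem_map.1 hx
    exact AddSubmonoid.subset_closure ⟨i, rfl⟩

lemma root_mem_qPlus (i : Fin n) : ρ.root i ∈ qPlus ρ := AddSubmonoid.subset_closure ⟨i, rfl⟩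

/-- The natural number `m` counts simple roots with multiplicity, so it vanishes only on the empty
sum. This is what separates Q⁺ from its negative. -/
lemma exists_apply_eq_of_mem_qPlus {a : H} (ha : ∀ i, ρ.root i a = 1) {α : Module.Dual ℂ H}
    (hα : α ∈ qPlus ρ) : ∃ m : ℕ, α a = m ∧ (m = 0 → α = 0) := by
  induction hα using AddSubmonoid.closure_induction with
  | mem x hx =>
    obtain ⟨i, rfl⟩ := hx
    exact ⟨1, by simp [ha], by simp⟩
  | zero => exact ⟨0, by simp, fun _ => rfl⟩
  | add x y _ _ hx hy =>
    obtain ⟨k, hk, hk'⟩ := hx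
    obtain ⟨l, hl, hl'⟩ := hy
    refine ⟨k + l, by simp [hk, hl], fun h => ?_⟩
    rw [hk' (by omega), hl' (by omega), add_zero]

lemma neg_notMem_qPlus [FiniteDimensional ℂ H] {α : Module.Dual ℂ H} (hα : α ∈ qPlus ρ)
    (h0 : α ≠ 0) : -α ∉ qPlus ρ := fun hα' => by
  obtain ⟨a, ha⟩ := ρ.exists_height
  obtain ⟨k, hk, hk'⟩ := exists_apply_eq_of_mem_qPlus ha hα
  obtain ⟨l, hl, -⟩ := exists_apply_eq_of_mem_qPlus ha hα'
  have : ((k + l : ℕ) : ℂ) = 0 := by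
    rw [Nat.cast_add, ← hk, ← hl, LinearMap.neg_apply, add_neg_cancel]
  exact h0 (hk' (by have := Nat.cast_eq_zero.1 this; omega))

end Height

namespace ChevalleyData

variable {n : ℕ} {A : Matrix (Fin n) (Fin n) ℤ} {H : Type*} [AddCommGroup H] [Module ℂ H]
  {ρ : Realization A H} {L : Type*} [LieRing L] [LieAlgebra ℂ L] (D : ChevalleyData ρ L)

/-! ### Weight components: exact description, finiteness, directness. -/

/-- The part of `pos` spanned by the words of weight `α`. -/
def posPart (α : Module.Dual ℂ H) : Submodule ℂ L :=
  Submodule.span ℂ {y | ∃ w i, ρ.wordRoot w + ρ.root i = α ∧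
    (y = D.adWord w (D.e i) ∨ y = D.J (D.adWord w (D.e i)))}

lemma posPart_le_pos (α : Module.Dual ℂ H) : D.posPart α ≤ D.pos := by
  refine Submodule.span_le.2 ?_
  rintro _ ⟨w, i, -, rfl | rfl⟩
  · exact D.adWord_mem_wordSpan w ⟨i, rfl⟩
  · exact D.J_mem_pos (D.adWord_mem_wordSpan w ⟨i, rfl⟩)

lemma posPart_le_wt (α : Module.Dual ℂ H) : D.posPart α ≤ D.wt α := by
  refine Submodule.span_le.2 ?_
  rintro _ ⟨w, i, rfl, rfl | rfl⟩
  · exact D.adWord_mem_wt w (D.e_mem_wt i)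
  · exact D.J_mem_wt (D.adWord_mem_wt w (D.e_mem_wt i))

lemma posPart_eq_bot {α : Module.Dual ℂ H} (h : ∀ w i, ρ.wordRoot w + ρ.root i ≠ α) :
    D.posPart α = ⊥ := by
  refine Submodule.span_eq_bot.2 ?_
  rintro _ ⟨w, i, hw, -⟩
  exact (h w i hw).elim

lemma posPart_eq_bot_of_notMem {α : Module.Dual ℂ H} (h : α ∉ qPlus ρ) : D.posPart α = ⊥ :=
  D.posPart_eq_bot fun w i hw =>
    h (hw ▸ add_mem (Realization.wordRoot_mem_qPlus w) (root_mem_qPlus i))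

lemma posPart_zero [FiniteDimensional ℂ H] : D.posPart 0 = ⊥ := by
  obtain ⟨a, ha⟩ := ρ.exists_height
  refine D.posPart_eq_bot fun w i hw => ?_
  have := LinearMap.congr_fun hw a
  rw [LinearMap.add_apply, Realization.wordRoot_apply ha, ha, LinearMap.zero_apply] at this
  exact Nat.cast_add_one_ne_zero _ this

lemma finite_posPart [FiniteDimensional ℂ H] (α : Module.Dual ℂ H) :
    Module.Finite ℂ (D.posPart α) := by
  obtain ⟨a, ha⟩ := ρ.exists_height
  -- The height of the weight fixes the length of the word, and there are finitely many words of
  -- each length. The `+ 1` accounts for the final letter `e i`.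
  have hW : {w : List (Fin n) | (w.length : ℂ) + 1 = α a}.Finite := by
    by_cases h : ∃ w : List (Fin n), (w.length : ℂ) + 1 = α a
    · obtain ⟨v, hv⟩ := h
      refine (List.finite_length_eq (Fin n) v.length).subset fun w hw => ?_
      have : (w.length : ℂ) = v.length := add_right_cancel (Eq.trans hw hv.symm)
      exact_mod_cast this
    · exact (Set.finite_empty).subset fun w hw => h ⟨w, hw⟩
  have hS := hW.prod (Set.finite_univ (α := Fin n))
  refine Module.Finite.iff_fg.2 (Submodule.fg_span (((hS.image
    fun p => D.adWord p.1 (D.e p.2)).union (hS.image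
      fun p => D.J (D.adWord p.1 (D.e p.2)))).subset ?_))
  rintro y ⟨w, i, hw, hy⟩
  have hmem : (w, i) ∈ {w : List (Fin n) | (w.length : ℂ) + 1 = α a} ×ˢ
      (Set.univ : Set (Fin n)) := by
    refine ⟨?_, Set.mem_univ _⟩
    have := LinearMap.congr_fun hw a
    rwa [LinearMap.add_apply, Realization.wordRoot_apply ha, ha] at this
  obtain rfl | rfl := hy
  · exact Or.inl ⟨_, hmem, rfl⟩
  · exact Or.inr ⟨_, hmem, rfl⟩

lemma pos_le {V : Submodule ℂ L} (h : ∀ w i, D.posPart (ρ.wordRoot w + ρ.root i) ≤ V) :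
    D.pos ≤ V := by
  refine Submodule.span_le.2 ?_
  rintro _ ⟨w, _, ⟨i, rfl⟩, hy⟩
  exact h w i (Submodule.subset_span ⟨w, i, rfl, hy⟩)

open Classical in
-- The right sides lie in the weight spaces and together span `L`. A family bounded above by an
-- independent one and with full supremum must equal it.
lemma wt_eq (α : Module.Dual ℂ H) :
    D.wt α = D.posPart α ⊔ (D.swap.posPart (-α) ⊔ if α = 0 then D.zero else ⊥) := by
  set U : Module.Dual ℂ H → Submodule ℂ L := fun α =>
    D.posPart α ⊔ (D.swap.posPart (-α) ⊔ if α = 0 then D.zero else ⊥) with hU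
  have hle : U ≤ D.wt := fun α => by
    refine sup_le (D.posPart_le_wt α) (sup_le ?_ ?_)
    · simpa [swap_wt] using D.swap.posPart_le_wt (-α)
    · split_ifs with h
      · exact h ▸ D.zero_le_wt
      · exact bot_le
  have htop : iSup U = ⊤ := by
    refine eq_top_iff.2 (D.neg_sup_zero_sup_pos ▸ sup_le ?_ (sup_le ?_ ?_))
    · refine D.swap.pos_le fun w i => ?_
      refine le_trans ?_ (le_iSup U (-(ρ.wordRoot w + ρ.root i)))
      exact le_sup_of_le_right (le_sup_of_le_left (by rw [neg_neg]))
    · refine le_trans ?_ (le_iSup U 0)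
      exact le_sup_of_le_right (le_sup_of_le_right (by rw [if_pos rfl]))
    · exact D.pos_le fun w i => le_trans le_sup_left (le_iSup U _)
  exact (congrFun ((D.iSupIndep_wt.le_iff_eq_of_iSup_eq_top htop).1 hle) α).symm

lemma wt_zero [FiniteDimensional ℂ H] : D.wt 0 = D.zero := by
  simp [wt_eq, posPart_zero]

lemma wt_le_pos [FiniteDimensional ℂ H] {α : Module.Dual ℂ H} (hα : α ∈ qPlus ρ) (h0 : α ≠ 0) :
    D.wt α ≤ D.pos := by
  rw [wt_eq, if_neg h0, D.swap.posPart_eq_bot_of_notMem (neg_notMem_qPlus hα h0), sup_bot_eq,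
    sup_bot_eq]
  exact D.posPart_le_pos α

lemma wt_neg_le_neg [FiniteDimensional ℂ H] {α : Module.Dual ℂ H} (hα : α ∈ qPlus ρ)
    (h0 : α ≠ 0) : D.wt (-α) ≤ D.neg := by
  rw [← swap_wt]
  exact D.swap.wt_le_pos hα h0

lemma finite_zero [FiniteDimensional ℂ H] : Module.Finite ℂ D.zero :=
  inferInstanceAs (Module.Finite ℂ (LinearMap.range D.cartanHom))

lemma finite_wt [FiniteDimensional ℂ H] (α : Module.Dual ℂ H) : Module.Finite ℂ (D.wt α) := by
  rw [wt_eq]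
  refine Module.Finite.iff_fg.2 (Submodule.FG.sup (Module.Finite.iff_fg.1 (D.finite_posPart α))
    (Submodule.FG.sup (Module.Finite.iff_fg.1 (D.swap.finite_posPart _)) ?_))
  split_ifs
  · exact Module.Finite.iff_fg.1 D.finite_zero
  · exact Submodule.fg_bot

lemma iSup_wt : ⨆ α : {α : Module.Dual ℂ H // α ∈ qPlus ρ ∨ -α ∈ qPlus ρ}, D.wt α.1 = ⊤ := by
  refine eq_top_iff.2 (D.neg_sup_zero_sup_pos ▸ sup_le ?_ (sup_le ?_ ?_))
  · refine D.swap.pos_le fun w i => (D.swap.posPart_le_wt _).trans ?_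
    rw [swap_wt]
    have h : ρ.wordRoot w + ρ.root i ∈ qPlus ρ :=
      add_mem (Realization.wordRoot_mem_qPlus w) (root_mem_qPlus i)
    exact le_iSup (fun α : {α : Module.Dual ℂ H // α ∈ qPlus ρ ∨ -α ∈ qPlus ρ} => D.wt α.1)
      ⟨-(ρ.wordRoot w + ρ.root i), Or.inr (by rwa [neg_neg])⟩
  · exact D.zero_le_wt.trans
      (le_iSup (fun α : {α : Module.Dual ℂ H // α ∈ qPlus ρ ∨ -α ∈ qPlus ρ} => D.wt α.1)
        ⟨0, Or.inl (zero_mem _)⟩)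
  · refine D.pos_le fun w i => (D.posPart_le_wt _).trans ?_
    exact le_iSup (fun α : {α : Module.Dual ℂ H // α ∈ qPlus ρ ∨ -α ∈ qPlus ρ} => D.wt α.1)
      ⟨ρ.wordRoot w + ρ.root i,
        Or.inl (add_mem (Realization.wordRoot_mem_qPlus w) (root_mem_qPlus i))⟩

/-- The three pieces are supported on weights of negative height, the zero weight and weights of
positive height. These index sets are pairwise disjoint, so independence of weight spaces applies.
-/
lemma iSupIndep_triangular [FiniteDimensional ℂ H] : iSupIndep ![D.neg, D.zero, D.pos] := by
  obtain ⟨a, ha⟩ := ρ.exists_height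
  let sP : Set (Module.Dual ℂ H) := {α | ∃ m : ℕ, α a = m + 1}
  let sN : Set (Module.Dual ℂ H) := {α | ∃ m : ℕ, (-α) a = m + 1}
  let sZ : Set (Module.Dual ℂ H) := {0}
  have hP : D.pos ≤ ⨆ α ∈ sP, D.wt α := D.pos_le fun w i => (D.posPart_le_wt _).trans
    (le_iSup₂_of_le _ ⟨w.length, by
      rw [LinearMap.add_apply, Realization.wordRoot_apply ha, ha]⟩ le_rfl)
  have hN : D.neg ≤ ⨆ α ∈ sN, D.wt α := D.swap.pos_le fun w i =>
    (D.swap.posPart_le_wt _).trans (by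
      rw [swap_wt]
      refine le_iSup₂_of_le _ ⟨w.length, ?_⟩ le_rfl
      rw [neg_neg, LinearMap.add_apply, Realization.wordRoot_apply ha, ha])
  have hZ : D.zero ≤ ⨆ α ∈ sZ, D.wt α := D.zero_le_wt.trans (le_iSup₂_of_le 0 rfl le_rfl)
  have hPN : Disjoint sP sN := Set.disjoint_left.2 fun α ⟨k, hk⟩ ⟨l, hl⟩ => by
    rw [LinearMap.neg_apply, hk] at hl
    have : ((k + l + 1 : ℕ) : ℂ) + 1 = 0 := by push_cast; linear_combination -hl
    exact Nat.cast_add_one_ne_zero _ this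
  have hPZ : Disjoint sP sZ := Set.disjoint_left.2 fun α ⟨k, hk⟩ h => by
    rw [Set.mem_singleton_iff.1 h, LinearMap.zero_apply] at hk
    exact Nat.cast_add_one_ne_zero _ hk.symm
  have hNZ : Disjoint sN sZ := Set.disjoint_left.2 fun α ⟨k, hk⟩ h => by
    rw [Set.mem_singleton_iff.1 h, neg_zero, LinearMap.zero_apply] at hk
    exact Nat.cast_add_one_ne_zero _ hk.symm
  have key {s t u : Set (Module.Dual ℂ H)} (hst : Disjoint s t) (hsu : Disjoint s u) :
      Disjoint (⨆ α ∈ s, D.wt α) ((⨆ α ∈ t, D.wt α) ⊔ ⨆ α ∈ u, D.wt α) := by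
    rw [← iSup_union]
    exact D.iSupIndep_wt.disjoint_biSup_biSup (hst.union_right hsu)
  exact iSupIndep_fin_three.2
    ⟨(key hNZ hPN.symm).mono hN (sup_le_sup hZ hP),
      (key hPZ.symm hNZ.symm).mono hZ (sup_le_sup hP hN),
      (key hPN hPZ).mono hP (sup_le_sup hN hZ)⟩

lemma isInternal_triangular [FiniteDimensional ℂ H] :
    DirectSum.IsInternal ![D.neg, D.zero, D.pos] := by
  rw [DirectSum.isInternal_submodule_iff_iSupIndep_and_iSup_eq_top]
  refine ⟨D.iSupIndep_triangular, ?_⟩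
  rw [iSup_fin_three, ← D.neg_sup_zero_sup_pos, ← sup_assoc]
  rfl

end ChevalleyData

namespace ChevalleyData

variable {n : ℕ} {A : Matrix (Fin n) (Fin n) ℤ} {H : Type*} [AddCommGroup H] [Module ℂ H]
  {ρ : Realization A H} {L : Type*} [LieRing L] [LieAlgebra ℂ L] (D : ChevalleyData ρ L)

/-! ### Passage to quotients, and the Serre elements. -/

/-- Transport along a surjective homomorphism commuting with the operators `J`. -/
def map {L' : Type*} [LieRing L'] [LieAlgebra ℂ L'] (φ : L →ₗ[ℂ] L')
    (hφ : ∀ x y, φ ⁅x, y⁆ = ⁅φ x, φ y⁆) (hs : Function.Surjective φ) (J' : L' →ₗ[ℂ] L')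
    (hJ : ∀ x, J' (φ x) = φ (D.J x)) : ChevalleyData ρ L' where
  J := J'
  e i := φ (D.e i)
  f i := φ (D.f i)
  h := φ ∘ₗ D.h
  J_J x := by
    obtain ⟨x, rfl⟩ := hs x
    rw [hJ, hJ, D.J_J, map_neg]
  J_lie x y := by
    obtain ⟨x, rfl⟩ := hs x
    obtain ⟨y, rfl⟩ := hs y
    rw [hJ, ← hφ, ← hφ, hJ, D.J_lie]
  lie_h_h a b := by
    rw [LinearMap.comp_apply, LinearMap.comp_apply, ← hφ, D.lie_h_h, map_zero]
  lie_h_e a i := by rw [LinearMap.comp_apply, ← hφ, D.lie_h_e, map_smul]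
  lie_h_f a i := by rw [LinearMap.comp_apply, ← hφ, D.lie_h_f, map_neg, map_smul]
  lie_e_f i j := by rw [← hφ, D.lie_e_f, apply_ite φ, map_zero]; rfl
  gen S hSJ he hf hh := by
    let S' : LieSubalgebra ℂ L :=
      { S.toSubmodule.comap φ with
        lie_mem' := fun {x y} hx hy => by
          change φ ⁅x, y⁆ ∈ S
          rw [hφ]
          exact S.lie_mem hx hy }
    have hS' : S' = ⊤ := D.gen S'
      (fun x hx => by change φ (D.J x) ∈ S; rw [← hJ]; exact hSJ _ hx) he hf hh
    refine eq_top_iff.2 fun y _ => ?_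
    obtain ⟨x, rfl⟩ := hs y
    exact (hS' ▸ LieSubalgebra.mem_top x : x ∈ S')

lemma ad_pow_mem_wt {x : L} {α β : Module.Dual ℂ H} {y : L} (hx : x ∈ D.wt α) (hy : y ∈ D.wt β)
    (m : ℕ) : (LieAlgebra.ad ℂ L x ^ m) y ∈ D.wt (m • α + β) := by
  induction m with
  | zero => simpa using hy
  | succ m ih =>
    rw [pow_succ', Module.End.mul_apply, LieAlgebra.ad_apply, succ_nsmul', add_assoc]
    exact D.lie_mem_wt hx ih

lemma lie_ad_pow_of_commute {x y z : L} (h : ⁅z, x⁆ = 0) (m : ℕ) :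
    ⁅z, (LieAlgebra.ad ℂ L x ^ m) y⁆ = (LieAlgebra.ad ℂ L x ^ m) ⁅z, y⁆ := by
  induction m with
  | zero => simp
  | succ m ih =>
    rw [pow_succ', Module.End.mul_apply, Module.End.mul_apply, LieAlgebra.ad_apply,
      LieAlgebra.ad_apply, leibniz_lie, h, zero_lie, zero_add, ih]

/-- The sl₂ computation for a lowest weight vector `x`. Each passage of `f j` past an `e j`
contributes the eigenvalue `2k + β(α_j^∨)` of the coroot, and summing over `k = 0, …, m` gives the
coefficient. -/
lemma lie_f_ad_pow (hA : IsGCM A) (j : Fin n) {x : L} {β : Module.Dual ℂ H} (hx : x ∈ D.wt β)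
    (hfx : ⁅D.f j, x⁆ = 0) (m : ℕ) :
    ⁅D.f j, (LieAlgebra.ad ℂ L (D.e j) ^ (m + 1)) x⁆ =
      -(((m + 1) * (β (ρ.coroot j) + m) : ℂ) • (LieAlgebra.ad ℂ L (D.e j) ^ m) x) := by
  have step (k : ℕ) : ⁅D.f j, (LieAlgebra.ad ℂ L (D.e j) ^ (k + 1)) x⁆ =
      -((2 * k + β (ρ.coroot j) : ℂ) • (LieAlgebra.ad ℂ L (D.e j) ^ k) x) +
        ⁅D.e j, ⁅D.f j, (LieAlgebra.ad ℂ L (D.e j) ^ k) x⁆⁆ := by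
    rw [pow_succ', Module.End.mul_apply, LieAlgebra.ad_apply, leibniz_lie, D.lie_f_e,
      if_pos rfl, neg_lie, D.ad_pow_mem_wt (D.e_mem_wt j) hx k (ρ.coroot j)]
    simp [ρ.pairing, hA.diag, mul_comm]
  induction m with
  | zero =>
    rw [step]
    simp [hfx]
  | succ m ih =>
    rw [step, ih, lie_neg, lie_smul, ← LieAlgebra.ad_apply (R := ℂ) (x := D.e j),
      ← Module.End.mul_apply, ← pow_succ', ← neg_add, ← add_smul]
    congr 2
    push_cast
    ring

/-- Write `A j i = -m`. For `k = j` the factor `β(α_j^∨) + m` of `lie_f_ad_pow` vanishes. For other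
`k`, `f k` commutes with `e j` and acts only on `e i`. This gives 0 unless `k = i`, when the result
is a multiple of `(ad e_j)^m e_j`: zero for `m > 0`, while for `m = 0` its coefficient `A i j` is
zero because `A j i` is. -/
lemma lie_f_serre (hA : IsGCM A) {i j : Fin n} (hij : i ≠ j) (k : Fin n) :
    ⁅D.f k, (LieAlgebra.ad ℂ L (D.e j) ^ (1 - A j i).toNat) (D.e i)⁆ = 0 := by
  have hle : A j i ≤ 0 := hA.offDiag j i hij.symm
  obtain ⟨m, hm⟩ : ∃ m : ℕ, A j i = -m := ⟨(-A j i).toNat, by omega⟩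
  have hm1 : (1 - A j i).toNat = m + 1 := by omega
  rw [hm1]
  by_cases hkj : k = j
  · subst hkj
    rw [D.lie_f_ad_pow hA k (D.e_mem_wt i) (by rw [D.lie_f_e, if_neg hij, neg_zero]),
      ρ.pairing, hm]
    simp
  · rw [lie_ad_pow_of_commute (by rw [D.lie_f_e, if_neg (Ne.symm hkj), neg_zero])]
    by_cases hki : k = i
    · subst hki
      rw [D.lie_f_e, if_pos rfl, map_neg, neg_eq_zero, pow_succ, Module.End.mul_apply,
        LieAlgebra.ad_apply, ← lie_skew, D.lie_h_e, ρ.pairing]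
      rcases m with _ | m
      · rw [hA.zero_symm j k (by simpa using hm)]
        simp
      · rw [pow_succ, Module.End.mul_apply, LieAlgebra.ad_apply, lie_neg, lie_smul, lie_self]
        simp
    · rw [D.lie_f_e, if_neg (Ne.symm hki), neg_zero, map_zero]

/-- All factors `J` come out of the brackets, so choosing `J e_k` instead of `e_k` changes a Serre
element only by a power of `J`. -/
lemma exists_ad_pow_eq_J_pow (a b : ℕ) (x y : L) (m : ℕ) :
    ∃ k : ℕ, (LieAlgebra.ad ℂ L ((D.J ^ a) x) ^ m) ((D.J ^ b) y) =
      (D.J ^ k) ((LieAlgebra.ad ℂ L x ^ m) y) := by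
  have hl (x y : L) (a : ℕ) : ⁅(D.J ^ a) x, y⁆ = (D.J ^ a) ⁅x, y⁆ := by
    induction a with
    | zero => simp
    | succ a ih => rw [pow_succ', Module.End.mul_apply, Module.End.mul_apply, D.J_lie, ih]
  have hr (x y : L) (a : ℕ) : ⁅x, (D.J ^ a) y⁆ = (D.J ^ a) ⁅x, y⁆ := by
    rw [← lie_skew, hl, ← lie_skew x y, map_neg]
  induction m with
  | zero => exact ⟨b, by simp⟩
  | succ m ih =>
    obtain ⟨k, hk⟩ := ih
    refine ⟨a + k, ?_⟩
    rw [pow_succ', Module.End.mul_apply, hk, LieAlgebra.ad_apply, hl, hr, pow_succ',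
      Module.End.mul_apply, LieAlgebra.ad_apply, pow_add, Module.End.mul_apply]

lemma J_pow_mem {V : Submodule ℂ L} (hJ : ∀ x ∈ V, D.J x ∈ V) (k : ℕ) {x : L} (hx : x ∈ V) :
    (D.J ^ k) x ∈ V := by
  induction k with
  | zero => simpa using hx
  | succ k ih => rw [pow_succ', Module.End.mul_apply]; exact hJ _ ih

/-- The elements `(ad ε_j) ^ (1 - A_ji) ε_i` for `i ≠ j`, with `ε_k = e_k` or `J e_k`. -/
def serreSet : Set L :=
  {x | ∃ i j : Fin n, i ≠ j ∧ ∃ εi ∈ ({D.e i, D.J (D.e i)} : Set L),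
    ∃ εj ∈ ({D.e j, D.J (D.e j)} : Set L), x = (LieAlgebra.ad ℂ L εj ^ (1 - A j i).toNat) εi}

/-- The Serre elements without `J` are weight vectors killed by every `ad (f k)`, so the ideal is
spanned by e-words applied to them and their `J`-images; it never leaves `pos`. -/
lemma lieSpan_serreSet_le_pos (hA : IsGCM A) :
    (LieSubmodule.lieSpan ℂ L D.serreSet).toSubmodule ≤ D.pos := by
  let X : Set L := {x | ∃ i j : Fin n, i ≠ j ∧
    x = (LieAlgebra.ad ℂ L (D.e j) ^ (1 - A j i).toNat) (D.e i)}
  refine (D.lieSpan_le_wordSpan (X := X) ?_ ?_ ?_).trans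
    (D.wordSpan_le_of_stable (fun _ => D.J_mem_pos) (fun i _ => D.lie_e_mem_wordSpan i) ?_)
  · rintro _ ⟨i, j, -, rfl⟩
    exact ⟨_, D.ad_pow_mem_wt (D.e_mem_wt j) (D.e_mem_wt i) _⟩
  · rintro k _ ⟨i, j, hij, rfl⟩
    exact D.lie_f_serre hA hij k
  · have hε {i : Fin n} {ε : L} (h : ε ∈ ({D.e i, D.J (D.e i)} : Set L)) :
        ∃ a : ℕ, ε = (D.J ^ a) (D.e i) := by
      obtain rfl | rfl := h
      · exact ⟨0, by simp⟩
      · exact ⟨1, by simp⟩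
    rintro _ ⟨i, j, hij, εi, hi, εj, hj, rfl⟩
    obtain ⟨b, rfl⟩ := hε hi
    obtain ⟨a, rfl⟩ := hε hj
    obtain ⟨k, hk⟩ := D.exists_ad_pow_eq_J_pow a b (D.e j) (D.e i) (1 - A j i).toNat
    rw [hk]
    exact D.J_pow_mem (fun _ => D.J_mem_wordSpan) k (D.subset_wordSpan ⟨i, j, hij, rfl⟩)
  · rintro _ ⟨i, j, -, rfl⟩
    induction (1 - A j i).toNat with
    | zero => exact D.e_mem_pos i
    | succ m ih =>
      rw [pow_succ', Module.End.mul_apply]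
      exact D.lie_e_mem_wordSpan j ih

end ChevalleyData

/-! ### Chevalley generators of g̃(A) and g(A). -/

section Presentation

variable {n : ℕ} {A : Matrix (Fin n) (Fin n) ℤ} {H : Type*} [AddCommGroup H] [Module ℂ H]

/-- The remaining generators of ĝ, the elements `v ⊗ j`, are the `J`-images of the `v ⊗ 1`. -/
lemma freeQ_eq_top {S : LieSubalgebra ℂ (FreeQ n H)} (hJ : ∀ x ∈ S, freeJ n H x ∈ S)
    (hS : ∀ v, freeGen n H v ∈ S) : S = ⊤ := by
  let _ : LieRing (QTensor n H) := LieRing.ofAssociativeRing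
  have key : ∀ x (hx : x ∈ freeSub n H), (⟨x, hx⟩ : FreeQ n H) ∈ S := fun x hx => by
    induction hx using LieSubalgebra.lieSpan_induction with
    | mem y hy =>
      obtain ⟨v, rfl⟩ | ⟨v, rfl⟩ := hy
      · exact hS v
      · have := hJ _ (hS v)
        have h2 : (freeJ n H (freeGen n H v)).1 = tens (T0.ι n H v) unitJ := by
          change elJ n H * tens (T0.ι n H v) 1 = _
          rw [elJ_mul_tens, mul_one]
        rwa [show freeJ n H (freeGen n H v) = ⟨tens (T0.ι n H v) unitJ, _⟩ from
          Subtype.ext h2] at this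
    | zero => exact S.zero_mem
    | add y z _ _ hy hz => exact S.add_mem hy hz
    | smul c y _ hy => exact S.smul_mem c hy
    | lie y z _ _ hy hz => exact S.lie_mem hy hz
  exact eq_top_iff.2 fun x _ => key x.1 x.2

lemma freeGen_mem {S : LieSubalgebra ℂ (FreeQ n H)} (he : ∀ i, eHat H i ∈ S)
    (hf : ∀ i, fHat H i ∈ S) (hh : ∀ a, hHat n a ∈ S) (v : GenSpace n H) :
    freeGen n H v ∈ S := by
  obtain ⟨a, b, c⟩ := v
  have hv : freeGen n H (a, b, c) =
      (∑ i, a i • eHat H i) + ((∑ i, b i • fHat H i) + hHat n c) := by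
    simp only [eHat, fHat, hHat, ← map_smul, ← map_sum, ← map_add]
    congr 1
    refine Prod.ext ?_ (Prod.ext ?_ ?_)
    · ext k
      simp [Prod.fst_sum, Finset.sum_apply, Pi.single_apply]
    · ext k
      simp [Prod.fst_sum, Prod.snd_sum, Finset.sum_apply, Pi.single_apply]
    · simp [Prod.snd_sum]
  rw [hv]
  exact S.add_mem (sum_mem fun i _ => S.smul_mem _ (he i))
    (S.add_mem (sum_mem fun i _ => S.smul_mem _ (hf i)) (hh c))

lemma toUniv_eq_zero {ρ : Realization A H} {x : FreeQ n H} :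
    toUniv ρ x = 0 ↔ x ∈ relIdeal ρ := LieSubmodule.Quotient.mk_eq_zero' (N := relIdeal ρ)

lemma toUniv_eq_zero_of_relator {ρ : Realization A H} {x : FreeQ n H} (hx : Relator ρ x) :
    toUniv ρ x = 0 := toUniv_eq_zero.2 (LieSubmodule.subset_lieSpan hx)

/-- The Chevalley generators of `g̃(A)`. -/
noncomputable def univData (ρ : Realization A H) : ChevalleyData ρ (Univ ρ) where
  J := univJ ρ
  e i := toUniv ρ (eHat H i)
  f i := toUniv ρ (fHat H i)
  h := toUniv ρ ∘ₗ freeGen n H ∘ₗ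
    LinearMap.inr ℂ (Fin n → ℂ) ((Fin n → ℂ) × H) ∘ₗ LinearMap.inr ℂ (Fin n → ℂ) H
  J_J := univJ_univJ ρ
  J_lie x y := (univJ_lie ρ x y).symm
  lie_h_h a b := toUniv_eq_zero_of_relator (.hh a b)
  lie_h_e a i := by
    have := toUniv_eq_zero_of_relator (.he (ρ := ρ) a i)
    rw [map_sub, sub_eq_zero, map_smul] at this
    exact this
  lie_h_f a i := by
    have := toUniv_eq_zero_of_relator (.hf (ρ := ρ) a i)
    rw [map_add, map_smul, add_eq_zero_iff_eq_neg] at this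
    exact this
  lie_e_f i j := by
    have := toUniv_eq_zero_of_relator (.ef (ρ := ρ) i j)
    rw [map_sub, sub_eq_zero, apply_ite (toUniv ρ), map_zero] at this
    exact this
  gen S hJ he hf hh := by
    let S' : LieSubalgebra ℂ (FreeQ n H) :=
      { S.toSubmodule.comap (toUniv ρ) with
        lie_mem' := fun {x y} hx hy => by
          change toUniv ρ ⁅x, y⁆ ∈ S
          rw [toUniv_lie]
          exact S.lie_mem hx hy }
    have hS' : S' = ⊤ := freeQ_eq_top
      (fun x hx => by
        change toUniv ρ (freeJ n H x) ∈ S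
        rw [← univJ_toUniv]
        exact hJ _ hx)
      (freeGen_mem he hf hh)
    refine eq_top_iff.2 fun y _ => ?_
    obtain ⟨x, rfl⟩ := toUniv_surjective ρ y
    exact (hS' ▸ LieSubalgebra.mem_top x : x ∈ S')

/-- The Chevalley generators of `g(A)`. -/
noncomputable def stdData (ρ : Realization A H) : ChevalleyData ρ (Std ρ) :=
  (univData ρ).map (toStd ρ) (fun _ _ => rfl) (toStd_surjective ρ) (J ρ) fun _ => rfl

end Presentation

/-! ### Representations of ĝ on algebras extended by the quaternions. -/

section Representation

variable {n : ℕ} {A : Matrix (Fin n) (Fin n) ℤ} {H : Type*} [AddCommGroup H] [Module ℂ H]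

/-- A `J`-stable ideal of `ĝ` containing the relators without `J` contains all of them. -/
lemma relIdeal_le {ρ : Realization A H} {I : LieIdeal ℂ (FreeQ n H)}
    (hJ : ∀ x ∈ I, freeJ n H x ∈ I)
    (hh : ∀ a b : H, ⁅hHat n a, hHat n b⁆ ∈ I)
    (he : ∀ (a : H) i, ⁅hHat n a, eHat H i⁆ - ρ.root i a • eHat H i ∈ I)
    (hf : ∀ (a : H) i, ⁅hHat n a, fHat H i⁆ + ρ.root i a • fHat H i ∈ I)
    (ef : ∀ i j, ⁅eHat H i, fHat H j⁆ - (if i = j then hHat n (ρ.coroot i) else 0) ∈ I) :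
    relIdeal ρ ≤ I := by
  have key {x y : FreeQ n H} (hx : x ∈ I) (h : freeJ n H x = y) : y ∈ I := h ▸ hJ x hx
  have key' {x y : FreeQ n H} (hx : x ∈ I) (h : -x = y) : y ∈ I := h ▸ neg_mem hx
  refine LieSubmodule.lieSpan_le.2 fun x hx => ?_
  change x ∈ I
  cases hx with
  | hh a b => exact hh a b
  | he a i => exact he a i
  | hf a i => exact hf a i
  | ef i j => exact ef i j
  | hJh a b => exact key (hh a b) (freeJ_lie_right _ _).symm
  | JhJh a b =>
    exact key' (hh a b) (by rw [freeJ_lie_right, ← freeJ_lie, freeJ_freeJ])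
  | Jhe a i => exact key (he a i) (by rw [map_sub, map_smul, freeJ_lie])
  | hJe a i => exact key (he a i) (by rw [map_sub, map_smul, freeJ_lie_right])
  | JhJe a i =>
    exact key' (he a i) (by rw [freeJ_lie_right, ← freeJ_lie, freeJ_freeJ, neg_sub', sub_neg_eq_add])
  | Jhf a i => exact key (hf a i) (by rw [map_add, map_smul, freeJ_lie])
  | hJf a i => exact key (hf a i) (by rw [map_add, map_smul, freeJ_lie_right])
  | JhJf a i =>
    exact key' (hf a i) (by rw [freeJ_lie_right, ← freeJ_lie, freeJ_freeJ, neg_add'])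
  | Jef i j =>
    exact key (ef i j) (by rw [map_sub, freeJ_lie, apply_ite (freeJ n H), map_zero])
  | eJf i j =>
    exact key (ef i j) (by rw [map_sub, freeJ_lie_right, apply_ite (freeJ n H), map_zero])
  | JeJf i j =>
    exact key' (ef i j) (by
      rw [freeJ_lie_right, ← freeJ_lie, freeJ_freeJ, neg_sub', sub_neg_eq_add])

variable {B : Type*} [Ring B] [Algebra ℂ B]

/-- The extension of scalars `B ⊗ ℍ` of a complex algebra `B`. -/
def QuatExt (B : Type*) [Ring B] [Algebra ℂ B] : Type _ := B ⊗[ℝ] ℍ[ℝ]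

noncomputable instance : Ring (QuatExt B) := inferInstanceAs (Ring (B ⊗[ℝ] ℍ[ℝ]))

noncomputable instance : Algebra ℂ (QuatExt B) := inferInstanceAs (Algebra ℂ (B ⊗[ℝ] ℍ[ℝ]))

/-- The pure tensor `b ⊗ c`. -/
noncomputable def QuatExt.mk (b : B) (c : ℍ[ℝ]) : QuatExt B := b ⊗ₜ[ℝ] c

lemma QuatExt.mk_mul_mk (a b : B) (c d : ℍ[ℝ]) : mk a c * mk b d = mk (a * b) (c * d) :=
  Algebra.TensorProduct.tmul_mul_tmul a b c d

/-- Contracting the quaternion factor with the real-part and `j`-part functionals isolates `a` and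
`b`. -/
lemma QuatExt.eq_zero_of_mk_add_mk {a b : B} (h : mk a 1 + mk b unitJ = 0) : a = 0 ∧ b = 0 := by
  have key (l : ℍ[ℝ] →ₗ[ℝ] ℝ) {c d : ℝ} (hc : l 1 = c) (hd : l unitJ = d) :
      c • a + d • b = 0 := by
    have h' : (a ⊗ₜ 1 + b ⊗ₜ unitJ : B ⊗[ℝ] ℍ[ℝ]) = 0 := h
    have := congrArg (TensorProduct.rid ℝ B ∘ TensorProduct.map LinearMap.id l) h'
    simpa [hc, hd] using this
  exact ⟨by simpa using key (QuaternionAlgebra.reₗ _ _ _) (c := 1) (d := 0) rfl rfl,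
    by simpa using key (QuaternionAlgebra.imJₗ _ _ _) (c := 0) (d := 1) rfl rfl⟩

/-- The extension of a linear map on the generators to the quaternion tensor algebra. -/
noncomputable def quatLift (φ : GenSpace n H →ₗ[ℂ] B) : QTensor n H →ₐ[ℂ] QuatExt B :=
  (Algebra.TensorProduct.map (TensorAlgebra.lift ℂ φ : T0 n H →ₐ[ℂ] B) (AlgHom.id ℝ ℍ[ℝ]) :
    T0 n H ⊗[ℝ] ℍ[ℝ] →ₐ[ℂ] B ⊗[ℝ] ℍ[ℝ])

lemma quatLift_tens (φ : GenSpace n H →ₗ[ℂ] B) (v : GenSpace n H) (c : ℍ[ℝ]) :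
    quatLift φ (tens (T0.ι n H v) c) = .mk (φ v) c := by
  refine (Algebra.TensorProduct.map_tmul _ _ _ _).trans ?_
  exact congrArg (· ⊗ₜ[ℝ] c) (TensorAlgebra.lift_ι_apply φ v)

lemma quatLift_mul_eq_zero (φ : GenSpace n H →ₗ[ℂ] B) (x : QTensor n H) {y : QTensor n H}
    (hy : quatLift φ y = 0) : quatLift φ (x * y) = 0 := by
  rw [map_mul, hy, mul_zero]

lemma quatLift_commutator_eq_zero (φ : GenSpace n H →ₗ[ℂ] B) (x : QTensor n H)
    {y : QTensor n H} (hy : quatLift φ y = 0) : quatLift φ (x * y - y * x) = 0 := by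
  rw [map_sub, map_mul, map_mul, hy, mul_zero, zero_mul, sub_zero]

/-- The kernel of the map `ĝ → B ⊗ ℍ` that extends a linear map on the generators. -/
noncomputable def kerIdeal (φ : GenSpace n H →ₗ[ℂ] B) : LieIdeal ℂ (FreeQ n H) where
  carrier := {x | quatLift φ x.1 = 0}
  add_mem' {x y} hx hy := ((map_add (quatLift φ) x.1 y.1).trans
    (congrArg₂ (· + ·) hx hy)).trans (add_zero 0)
  zero_mem' := map_zero (quatLift φ)
  smul_mem' c x hx := ((map_smul (quatLift φ) c x.1).trans (congrArg (c • ·) hx)).trans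
    (smul_zero c)
  lie_mem {x y} hy := by
    change quatLift φ (x.1 * y.1 - y.1 * x.1) = 0
    exact quatLift_commutator_eq_zero φ x.1 hy

lemma mem_kerIdeal {φ : GenSpace n H →ₗ[ℂ] B} {x : FreeQ n H} :
    x ∈ kerIdeal φ ↔ quatLift φ x.1 = 0 := Iff.rfl

lemma quatLift_freeGen (φ : GenSpace n H →ₗ[ℂ] B) (v : GenSpace n H) :
    quatLift φ (freeGen n H v).1 = .mk (φ v) 1 := quatLift_tens φ v 1

lemma quatLift_freeJ_freeGen (φ : GenSpace n H →ₗ[ℂ] B) (v : GenSpace n H) :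
    quatLift φ (freeJ n H (freeGen n H v)).1 = .mk (φ v) unitJ := by
  rw [← quatLift_tens]
  congr 1
  change elJ n H * tens (T0.ι n H v) 1 = _
  rw [elJ_mul_tens, mul_one]

lemma quatLift_lie (φ : GenSpace n H →ₗ[ℂ] B) (v w : GenSpace n H) :
    quatLift φ (⁅freeGen n H v, freeGen n H w⁆ : FreeQ n H).1 =
      .mk (φ v * φ w - φ w * φ v) 1 := by
  change quatLift φ ((freeGen n H v).1 * (freeGen n H w).1 -
    (freeGen n H w).1 * (freeGen n H v).1) = _
  rw [map_sub, map_mul, map_mul, quatLift_freeGen, quatLift_freeGen,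
    QuatExt.mk_mul_mk, QuatExt.mk_mul_mk, mul_one]
  exact (TensorProduct.sub_tmul _ _ _).symm

lemma relator_mem_kerIdeal {φ : GenSpace n H →ₗ[ℂ] B} {v w u : GenSpace n H}
    (h : φ v * φ w - φ w * φ v = φ u) :
    ⁅freeGen n H v, freeGen n H w⁆ - freeGen n H u ∈ kerIdeal φ := by
  rw [mem_kerIdeal]
  refine (map_sub (quatLift φ) _ _).trans ?_
  rw [quatLift_freeGen, sub_eq_zero]
  exact (quatLift_lie φ v w).trans (by rw [h])

/-- `J` is left multiplication by `1 ⊗ j`, so the kernel is `J`-stable. An ordinary complex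
representation of the Chevalley relations thus kills all the relators. -/
lemma relIdeal_le_kerIdeal (ρ : Realization A H) (φ : GenSpace n H →ₗ[ℂ] B)
    (hh : ∀ a b : H, φ (0, 0, a) * φ (0, 0, b) - φ (0, 0, b) * φ (0, 0, a) = 0)
    (he : ∀ (a : H) i, φ (0, 0, a) * φ (Pi.single i 1, 0, 0) -
      φ (Pi.single i 1, 0, 0) * φ (0, 0, a) = ρ.root i a • φ (Pi.single i 1, 0, 0))
    (hf : ∀ (a : H) i, φ (0, 0, a) * φ (0, Pi.single i 1, 0) -
      φ (0, Pi.single i 1, 0) * φ (0, 0, a) = -(ρ.root i a • φ (0, Pi.single i 1, 0)))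
    (ef : ∀ i j, φ (Pi.single i 1, 0, 0) * φ (0, Pi.single j 1, 0) -
      φ (0, Pi.single j 1, 0) * φ (Pi.single i 1, 0, 0) =
        if i = j then φ (0, 0, ρ.coroot i) else 0) :
    relIdeal ρ ≤ kerIdeal φ := by
  refine relIdeal_le ?_ (fun a b => ?_) (fun a i => ?_) (fun a i => ?_) (fun i j => ?_)
  · intro x hx
    exact quatLift_mul_eq_zero φ (elJ n H) (mem_kerIdeal.1 hx)
  · have := relator_mem_kerIdeal (φ := φ) (u := 0) ((hh a b).trans (map_zero φ).symm)
    rwa [map_zero, sub_zero] at this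
  · have := relator_mem_kerIdeal (φ := φ) ((he a i).trans (map_smul φ _ _).symm)
    rwa [map_smul] at this
  · have := relator_mem_kerIdeal (φ := φ) (u := -(ρ.root i a • (0, Pi.single i 1, 0)))
      ((hf a i).trans (by rw [map_neg, map_smul]))
    rwa [map_neg, map_smul, sub_neg_eq_add] at this
  · have := relator_mem_kerIdeal (φ := φ) (u := if i = j then (0, 0, ρ.coroot i) else 0)
      ((ef i j).trans (by rw [apply_ite φ, map_zero]))
    rwa [apply_ite (freeGen n H), map_zero] at this

end Representation

/-! ### Verma modules, and injectivity of H × H into g̃(A). -/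

section Verma

variable {n : ℕ} {A : Matrix (Fin n) (Fin n) ℤ} {H : Type*} [AddCommGroup H] [Module ℂ H]
  (ρ : Realization A H) (μ : Module.Dual ℂ H)

/-- The vector space with basis the words in the `f i`, on which `g̃(A)` acts with highest
weight `μ`. -/
abbrev WordModule (n : ℕ) : Type := List (Fin n) →₀ ℂ

lemma wordModule_hom_ext {φ ψ : Module.End ℂ (WordModule n)}
    (h : ∀ w, φ (Finsupp.single w 1) = ψ (Finsupp.single w 1)) : φ = ψ :=
  Finsupp.lhom_ext' fun w => LinearMap.ext_ring (h w)

/-- `f i` prepends the letter `i`. -/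
noncomputable def vermaF (i : Fin n) : Module.End ℂ (WordModule n) :=
  Finsupp.linearCombination ℂ fun w => Finsupp.single (i :: w) 1

/-- `h a` acts on the word `w` by the scalar `(μ - wordRoot w) a`. -/
noncomputable def vermaH : H →ₗ[ℂ] Module.End ℂ (WordModule n) where
  toFun a := Finsupp.linearCombination ℂ fun w => (μ - ρ.wordRoot w) a • Finsupp.single w 1
  map_add' a b := by
    refine wordModule_hom_ext fun w => ?_
    simp only [LinearMap.add_apply, Finsupp.linearCombination_single, one_smul, map_add, add_smul]
  map_smul' c a := by
    refine wordModule_hom_ext fun w => ?_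
    simp only [RingHom.id_apply, LinearMap.smul_apply, Finsupp.linearCombination_single, one_smul,
      map_smul, smul_assoc]

/-- The image of the word `w` under `e i`. -/
noncomputable def vermaEWord (i : Fin n) : List (Fin n) → WordModule n
  | [] => 0
  | j :: w => vermaF j (vermaEWord i w) +
      if i = j then (μ - ρ.wordRoot w) (ρ.coroot i) • Finsupp.single w 1 else 0

/-- The action of `e i`. -/
noncomputable def vermaE (i : Fin n) : Module.End ℂ (WordModule n) :=
  Finsupp.linearCombination ℂ (vermaEWord ρ μ i)

@[simp] lemma vermaF_single (i : Fin n) (w : List (Fin n)) :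
    vermaF i (Finsupp.single w 1) = Finsupp.single (i :: w) 1 := by simp [vermaF]

@[simp] lemma vermaH_single (a : H) (w : List (Fin n)) :
    vermaH ρ μ a (Finsupp.single w 1) = (μ - ρ.wordRoot w) a • Finsupp.single w 1 := by
  simp [vermaH]

@[simp] lemma vermaE_single (i : Fin n) (w : List (Fin n)) :
    vermaE ρ μ i (Finsupp.single w 1) = vermaEWord ρ μ i w := by simp [vermaE]

lemma vermaH_vermaF (a : H) (i : Fin n) (x : WordModule n) :
    vermaH ρ μ a (vermaF i x) = vermaF i (vermaH ρ μ a x) - ρ.root i a • vermaF i x := by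
  suffices vermaH ρ μ a * vermaF i = vermaF i * vermaH ρ μ a - ρ.root i a • vermaF i from
    LinearMap.congr_fun this x
  refine wordModule_hom_ext fun w => ?_
  simp only [Module.End.mul_apply, LinearMap.sub_apply, LinearMap.smul_apply, vermaF_single,
    vermaH_single, map_smul, Realization.wordRoot_cons, ← sub_smul, LinearMap.add_apply]
  congr 1
  ring

/-- The recursion defining `vermaEWord` was chosen to force this commutation relation. -/
lemma vermaE_vermaF (i j : Fin n) (x : WordModule n) :
    vermaE ρ μ i (vermaF j x) =
      vermaF j (vermaE ρ μ i x) + if i = j then vermaH ρ μ (ρ.coroot i) x else 0 := by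
  suffices vermaE ρ μ i * vermaF j = vermaF j * vermaE ρ μ i +
      if i = j then vermaH ρ μ (ρ.coroot i) else 0 by
    refine (LinearMap.congr_fun this x).trans ?_
    split_ifs <;> rfl
  refine wordModule_hom_ext fun w => ?_
  simp only [Module.End.mul_apply, LinearMap.add_apply, vermaF_single, vermaE_single, vermaEWord]
  split_ifs <;> simp

/-- `e i` raises weights by the `i`-th simple root; this is the relation between `h` and `e`, proved
by moving `h` through the recursion. -/
lemma vermaH_vermaEWord (a : H) (i : Fin n) (w : List (Fin n)) :
    vermaH ρ μ a (vermaEWord ρ μ i w) =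
      (μ - ρ.wordRoot w + ρ.root i) a • vermaEWord ρ μ i w := by
  induction w with
  | nil => simp [vermaEWord]
  | cons j w ih =>
    simp only [vermaEWord, map_add, vermaH_vermaF, ih, map_smul, smul_add]
    congr 1
    · rw [← sub_smul]
      congr 1
      simp only [Realization.wordRoot_cons, LinearMap.add_apply, LinearMap.sub_apply]
      ring
    · split_ifs with h
      · subst h
        rw [map_smul, vermaH_single, smul_comm]
        congr 2
        rw [Realization.wordRoot_cons]
        abel
      · simp

/-- The action of the generators on the Verma module of highest weight `μ`. -/
noncomputable def vermaGen : GenSpace n H →ₗ[ℂ] Module.End ℂ (WordModule n) :=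
  (Fintype.linearCombination ℂ (vermaE ρ μ)).coprod
    ((Fintype.linearCombination ℂ vermaF).coprod (vermaH ρ μ))

lemma vermaGen_e (i : Fin n) : vermaGen ρ μ (Pi.single i 1, 0, 0) = vermaE ρ μ i := by
  simp [vermaGen, Fintype.linearCombination_apply_single]

lemma vermaGen_f (i : Fin n) : vermaGen ρ μ (0, Pi.single i 1, 0) = vermaF i := by
  simp [vermaGen, Fintype.linearCombination_apply_single]

lemma vermaGen_h (a : H) : vermaGen ρ μ (0, 0, a) = vermaH ρ μ a := by
  simp [vermaGen]

lemma relIdeal_le_kerIdeal_vermaGen : relIdeal ρ ≤ kerIdeal (B := Module.End ℂ (WordModule n)) (vermaGen ρ μ) := by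
  refine relIdeal_le_kerIdeal ρ _ (fun a b => ?_) (fun a i => ?_) (fun a i => ?_) (fun i j => ?_)
  · simp only [vermaGen_h]
    refine wordModule_hom_ext fun w => ?_
    simp only [Module.End.mul_apply, LinearMap.sub_apply, vermaH_single, map_smul,
      LinearMap.zero_apply]
    rw [smul_comm, sub_self]
  · simp only [vermaGen_h, vermaGen_e]
    refine wordModule_hom_ext fun w => ?_
    simp only [Module.End.mul_apply, LinearMap.sub_apply, LinearMap.smul_apply, vermaE_single,
      vermaH_single, map_smul, vermaH_vermaEWord, ← sub_smul, LinearMap.add_apply,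
      add_sub_cancel_left]
  · simp only [vermaGen_h, vermaGen_f]
    refine LinearMap.ext fun x => ?_
    simp only [Module.End.mul_apply, LinearMap.sub_apply, LinearMap.smul_apply,
      LinearMap.neg_apply, vermaH_vermaF]
    abel
  · simp only [vermaGen_h, vermaGen_f, vermaGen_e]
    refine LinearMap.ext fun x => ?_
    simp only [Module.End.mul_apply, LinearMap.sub_apply, vermaE_vermaF, add_sub_cancel_left]
    split_ifs <;> rfl

lemma quatLift_vermaGen_eq_zero {x : FreeQ n H} (hx : x ∈ relIdeal ρ) :
    quatLift (B := Module.End ℂ (WordModule n)) (vermaGen ρ μ) x.1 = 0 := by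
  have h := relIdeal_le_kerIdeal_vermaGen ρ μ
  have h' : x ∈ kerIdeal (B := Module.End ℂ (WordModule n)) (vermaGen ρ μ) := h hx
  exact mem_kerIdeal.1 h'

/-- If `h + Jh'` vanishes, then `h` and `h'` act as zero on the Verma module of every highest weight
`μ`, because 1 and `j` separate the two components. Functionals separate the points of `H`. -/
lemma univData_cartanHom_injective : Function.Injective (univData ρ).cartanHom := by
  refine (injective_iff_map_eq_zero _).2 fun p hp => ?_
  have hp' : freeGen n H (0, 0, p.1) + freeJ n H (freeGen n H (0, 0, p.2)) ∈ relIdeal ρ := by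
    rw [← toUniv_eq_zero, map_add]
    exact hp
  have key (μ : Module.Dual ℂ H) : μ p.1 = 0 ∧ μ p.2 = 0 := by
    have h := quatLift_vermaGen_eq_zero ρ μ hp'
    have h' := (map_add (quatLift (B := Module.End ℂ (WordModule n)) (vermaGen ρ μ))
      (freeGen n H (0, 0, p.1)).1 (freeJ n H (freeGen n H (0, 0, p.2))).1).symm.trans h
    rw [quatLift_freeGen, quatLift_freeJ_freeGen, vermaGen_h, vermaGen_h] at h'
    have h0 {a : H} (ha : vermaH ρ μ a = 0) : μ a = 0 := by
      -- The empty word is the highest weight vector, on which `h a` acts by `μ a`.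
      have := LinearMap.congr_fun ha (Finsupp.single [] 1)
      rw [vermaH_single] at this
      simpa [Realization.wordRoot] using this
    exact (QuatExt.eq_zero_of_mk_add_mk h').imp h0 h0
  exact Prod.ext ((Module.forall_dual_apply_eq_zero_iff ℂ p.1).1 fun μ => (key μ).1)
    ((Module.forall_dual_apply_eq_zero_iff ℂ p.2).1 fun μ => (key μ).2)

end Verma

/-! ### Descent to g(A). -/

section Main

variable {n : ℕ} {A : Matrix (Fin n) (Fin n) ℤ} {H : Type*} [AddCommGroup H] [Module ℂ H]
  (ρ : Realization A H)

lemma idealPlus_le_pos (hA : IsGCM A) : (idealPlus ρ).toSubmodule ≤ (univData ρ).pos :=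
  (univData ρ).lieSpan_serreSet_le_pos hA

lemma idealMinus_le_neg (hA : IsGCM A) : (idealMinus ρ).toSubmodule ≤ (univData ρ).neg :=
  (univData ρ).swap.lieSpan_serreSet_le_pos hA

lemma toStd_eq_zero {x : Univ ρ} : toStd ρ x = 0 ↔ x ∈ serreIdeal ρ :=
  LieSubmodule.Quotient.mk_eq_zero' (N := serreIdeal ρ)

/-- An element of H + JH in the Serre ideal lies in `pos ⊔ neg`, hence vanishes already in g̃(A) by
independence of the triangular pieces. -/
lemma cartanMap_injective (hA : IsGCM A) [FiniteDimensional ℂ H] :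
    Function.Injective (cartanMap ρ) := by
  refine (injective_iff_map_eq_zero _).2 fun p hp => ?_
  have hp' : (univData ρ).cartanHom p ∈ serreIdeal ρ := by
    rw [← toStd_eq_zero, ChevalleyData.cartanHom_apply, map_add]
    exact hp
  obtain ⟨y, hy, z, hz, hyz⟩ := (LieSubmodule.mem_sup _ _ _).1 hp'
  have h0 := (iSupIndep_fin_three.1 (univData ρ).iSupIndep_triangular).2.1
  have h1 : (univData ρ).cartanHom p ∈ (univData ρ).pos ⊔ (univData ρ).neg :=
    hyz ▸ Submodule.add_mem_sup (idealPlus_le_pos ρ hA hy) (idealMinus_le_neg ρ hA hz)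
  have h2 : (univData ρ).cartanHom p = 0 := Submodule.disjoint_def.1 h0 _ ⟨p, rfl⟩ h1
  exact (injective_iff_map_eq_zero _).1 (univData_cartanHom_injective ρ) p h2

lemma nPlus_eq : (nPlus ρ).toSubmodule = (stdData ρ).pos := (stdData ρ).toSubmodule_lieSpan_e

lemma nMinus_eq : (nMinus ρ).toSubmodule = (stdData ρ).neg :=
  (stdData ρ).swap.toSubmodule_lieSpan_e

lemma cartan_eq : (cartan ρ).toSubmodule = (stdData ρ).zero := (stdData ρ).toSubmodule_lieSpan_h

/-- The eigenvalue equation is complex linear in `h`, so testing it on a spanning set is enough. -/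
lemma rootSpace_eq {Hr : Submodule ℝ H} (hHr : Submodule.span ℂ (Hr : Set H) = ⊤)
    (α : Module.Dual ℂ H) : rootSpace ρ Hr α = (stdData ρ).wt α := by
  ext x
  refine ⟨fun hx a => ?_, fun hx a _ => hx a⟩
  have ha : a ∈ Submodule.span ℂ (Hr : Set H) := hHr ▸ Submodule.mem_top
  induction ha using Submodule.span_induction with
  | mem a ha => exact hx a ha
  | zero => simp
  | add a b _ _ ha hb => rw [map_add, add_lie, ha, hb, map_add, add_smul]
  | smul c a _ ha => rw [map_smul, smul_lie, ha, map_smul, smul_assoc]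

lemma mem_wt_iff (α : Module.Dual ℂ H) (x : Std ρ) :
    x ∈ (stdData ρ).wt α ↔
      ∀ h h' : H, ⁅hMap ρ h + J ρ (hMap ρ h'), x⁆ = α h • x + α h' • J ρ x := by
  refine ⟨fun hx a b => ?_, fun hx a => ?_⟩
  · have ha : ⁅hMap ρ a, x⁆ = α a • x := hx a
    have hb : ⁅hMap ρ b, x⁆ = α b • x := hx b
    rw [add_lie, ← J_lie, ha, hb, map_smul]
  · have ha : ⁅hMap ρ a, x⁆ = α a • x := by simpa using hx a 0
    exact ha

lemma serre_relation {x : Univ ρ} {y : Univ ρ} {m : ℕ}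
    (h : (LieAlgebra.ad ℂ (Univ ρ) y ^ m) x ∈ serreIdeal ρ) :
    (LieAlgebra.ad ℂ (Std ρ) (toStd ρ y) ^ m) (toStd ρ x) = 0 := by
  -- With 0 rewritten as the image of the Serre element, the goal says only that the projection
  -- commutes with powers of `ad`, which allows induction on `m`.
  rw [← (toStd_eq_zero ρ).2 h]
  clear h
  induction m with
  | zero => rfl
  | succ m ih =>
    rw [pow_succ', pow_succ', Module.End.mul_apply, ih]
    rfl

end Main

end QuatKacMoody

theorem mainTheorem2 {n : ℕ} (A : Matrix (Fin n) (Fin n) ℤ) (hA : IsGCM A)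
    {H : Type*} [AddCommGroup H] [Module ℂ H] [FiniteDimensional ℂ H]
    (ρ : Realization A H) :
    -- triangular decomposition `g(A) = N⁻ ⊕ K ⊕ N⁺` with `K = H ⊕ J H`
    (DirectSum.IsInternal
        ![(nMinus ρ).toSubmodule, (cartan ρ).toSubmodule,
          (nPlus ρ).toSubmodule] ∧
      Function.Injective (cartanMap ρ) ∧
      (cartan ρ).toSubmodule = LinearMap.range (cartanMap ρ)) ∧
    -- root space decomposition, for every real subspace `Hr` spanning `H` over `ℂ`
    (∀ Hr : Submodule ℝ H, Submodule.span ℂ (Hr : Set H) = ⊤ →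
      iSupIndep (fun α : {α : Module.Dual ℂ H //
          α ∈ qPlus ρ ∨ -α ∈ qPlus ρ} =>
        rootSpace ρ Hr α.1) ∧
      (⨆ α : {α : Module.Dual ℂ H //
          α ∈ qPlus ρ ∨ -α ∈ qPlus ρ},
        rootSpace ρ Hr α.1) = ⊤ ∧
      rootSpace ρ Hr 0 = (cartan ρ).toSubmodule ∧
      (∀ h ∈ Hr, hMap ρ h ∈ rootSpace ρ Hr 0) ∧
      (∀ α : Module.Dual ℂ H, Module.Finite ℂ (rootSpace ρ Hr α)) ∧
      (∀ α ∈ qPlus ρ, α ≠ 0 →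
        -α ∉ qPlus ρ ∧
        rootSpace ρ Hr α ≤ (nPlus ρ).toSubmodule ∧
        rootSpace ρ Hr (-α) ≤ (nMinus ρ).toSubmodule) ∧
      (∀ (α : Module.Dual ℂ H) (x : Std ρ),
        x ∈ rootSpace ρ Hr α ↔
          ∀ h h' : H, ⁅hMap ρ h + J ρ (hMap ρ h'), x⁆ =
            α h • x + α h' • J ρ x)) ∧
    -- `K` is a maximal commutative subalgebra
    ((∀ x ∈ cartan ρ, ∀ y ∈ cartan ρ, ⁅x, y⁆ = 0) ∧
      ∀ x : Std ρ,
        (∀ y ∈ cartan ρ, ⁅x, y⁆ = 0) → x ∈ cartan ρ) ∧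
    -- commutation relations
    (∀ h h' : H,
      ⁅hMap ρ h, hMap ρ h'⁆ = 0 ∧
      ⁅hMap ρ h, J ρ (hMap ρ h')⁆ = 0 ∧
      ⁅J ρ (hMap ρ h), J ρ (hMap ρ h')⁆ = 0) ∧
    (∀ (h : H) (i : Fin n),
      ⁅hMap ρ h, e ρ i⁆ = ρ.root i h • e ρ i ∧
      ⁅J ρ (hMap ρ h), e ρ i⁆ =
        ρ.root i h • J ρ (e ρ i) ∧
      ⁅hMap ρ h, J ρ (e ρ i)⁆ =
        ρ.root i h • J ρ (e ρ i) ∧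
      ⁅J ρ (hMap ρ h), J ρ (e ρ i)⁆ =
        -(ρ.root i h • e ρ i) ∧
      ⁅hMap ρ h, f ρ i⁆ = -(ρ.root i h • f ρ i) ∧
      ⁅J ρ (hMap ρ h), f ρ i⁆ =
        -(ρ.root i h • J ρ (f ρ i)) ∧
      ⁅hMap ρ h, J ρ (f ρ i)⁆ =
        -(ρ.root i h • J ρ (f ρ i)) ∧
      ⁅J ρ (hMap ρ h), J ρ (f ρ i)⁆ =
        ρ.root i h • f ρ i) ∧
    (∀ i j : Fin n,
      ⁅e ρ i, f ρ j⁆ =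
        (if i = j then hMap ρ (ρ.coroot i) else 0) ∧
      ⁅J ρ (e ρ i), f ρ j⁆ =
        (if i = j then J ρ (hMap ρ (ρ.coroot i)) else 0) ∧
      ⁅e ρ i, J ρ (f ρ j)⁆ =
        (if i = j then J ρ (hMap ρ (ρ.coroot i)) else 0) ∧
      ⁅J ρ (e ρ i), J ρ (f ρ j)⁆ =
        (if i = j then -hMap ρ (ρ.coroot i) else 0)) ∧
    -- Serre relations
    (∀ i j : Fin n, i ≠ j →
      (∀ εi ∈ ({e ρ i, J ρ (e ρ i)} :
          Set (Std ρ)),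
        ∀ εj ∈ ({e ρ j, J ρ (e ρ j)} :
          Set (Std ρ)),
          (LieAlgebra.ad ℂ (Std ρ) εj ^ (1 - A j i).toNat) εi = 0) ∧
      ∀ φi ∈ ({f ρ i, J ρ (f ρ i)} :
          Set (Std ρ)),
        ∀ φj ∈ ({f ρ j, J ρ (f ρ j)} :
          Set (Std ρ)),
          (LieAlgebra.ad ℂ (Std ρ) φj ^ (1 - A j i).toNat) φi = 0) := by
  have hcomm : ∀ a b : H, ⁅hMap ρ a, hMap ρ b⁆ = 0 := (stdData ρ).lie_h_h
  have he : ∀ (a : H) i, ⁅hMap ρ a, e ρ i⁆ = ρ.root i a • e ρ i := (stdData ρ).lie_h_e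
  have hf : ∀ (a : H) i, ⁅hMap ρ a, f ρ i⁆ = -(ρ.root i a • f ρ i) := (stdData ρ).lie_h_f
  have hef : ∀ i j, ⁅e ρ i, f ρ j⁆ = if i = j then hMap ρ (ρ.coroot i) else 0 :=
    (stdData ρ).lie_e_f
  have lieJ : ∀ x y, ⁅x, J ρ y⁆ = J ρ ⁅x, y⁆ := (stdData ρ).lie_J
  have mem_cartan {x : Std ρ} : x ∈ cartan ρ ↔ x ∈ (stdData ρ).zero := by
    rw [← cartan_eq]; rfl
  have hzero : (stdData ρ).wt 0 = (stdData ρ).zero := (stdData ρ).wt_zero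
  refine ⟨⟨?_, cartanMap_injective ρ hA, cartan_eq ρ⟩, fun Hr hHr => ?_, ⟨?_, ?_⟩, ?_, ?_, ?_, ?_⟩
  · rw [nMinus_eq, cartan_eq, nPlus_eq]
    exact (stdData ρ).isInternal_triangular
  · simp only [rootSpace_eq ρ hHr, nMinus_eq, nPlus_eq, cartan_eq]
    exact ⟨(stdData ρ).iSupIndep_wt.comp Subtype.val_injective, (stdData ρ).iSup_wt, hzero,
      fun a _ => (stdData ρ).h_mem_wt a,
      fun α => rootSpace_eq ρ hHr α ▸ (stdData ρ).finite_wt α,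
      fun α hα h0 => ⟨neg_notMem_qPlus hα h0, (stdData ρ).wt_le_pos hα h0,
        (stdData ρ).wt_neg_le_neg hα h0⟩, mem_wt_iff ρ⟩
  · intro x hx y hy
    obtain ⟨p, rfl⟩ := mem_cartan.1 hx
    have := (mem_wt_iff ρ 0 y).1 ((stdData ρ).zero_le_wt (mem_cartan.1 hy)) p.1 p.2
    refine Eq.trans this ?_
    simp
  · intro x hx
    -- Maximality: an element commuting with `H` has weight 0, and the zero weight space is `K`.
    rw [mem_cartan, ← hzero]
    intro a
    rw [← lie_skew, hx _ (mem_cartan.2 ((stdData ρ).h_mem_zero a))]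
    simp
  · intro a b
    refine ⟨hcomm a b, ?_, ?_⟩
    · rw [lieJ, hcomm, map_zero]
    · rw [lieJ, ← J_lie, hcomm, map_zero, map_zero]
  · intro a i
    refine ⟨he a i, ?_, ?_, ?_, hf a i, ?_, ?_, ?_⟩
    · rw [← J_lie, he, map_smul]
    · rw [lieJ, he, map_smul]
    · rw [lieJ, ← J_lie, J_J, he]
    · rw [← J_lie, hf, map_neg, map_smul]
    · rw [lieJ, hf, map_neg, map_smul]
    · rw [lieJ, ← J_lie, J_J, hf, neg_neg]
  · intro i j
    refine ⟨hef i j, ?_, ?_, ?_⟩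
    · rw [← J_lie, hef, apply_ite (J ρ), map_zero]
    · rw [lieJ, hef, apply_ite (J ρ), map_zero]
    · rw [lieJ, ← J_lie, J_J, hef]
      split_ifs <;> simp
  · intro i j hij
    constructor
    · rintro _ hi _ hj
      have lift {k : Fin n} {x : Std ρ} (h : x ∈ ({e ρ k, J ρ (e ρ k)} : Set (Std ρ))) :
          ∃ y ∈ ({toUniv ρ (eHat H k), univJ ρ (toUniv ρ (eHat H k))} : Set (Univ ρ)),
            toStd ρ y = x := by
        obtain rfl | rfl := h
        · exact ⟨_, Or.inl rfl, rfl⟩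
        · exact ⟨_, Or.inr rfl, rfl⟩
      obtain ⟨x, hx, rfl⟩ := lift hi
      obtain ⟨y, hy, rfl⟩ := lift hj
      exact serre_relation ρ ((le_sup_left : idealPlus ρ ≤ serreIdeal ρ)
        (LieSubmodule.subset_lieSpan ⟨i, j, hij, x, hx, y, hy, rfl⟩))
    · rintro _ hi _ hj
      have lift {k : Fin n} {x : Std ρ} (h : x ∈ ({f ρ k, J ρ (f ρ k)} : Set (Std ρ))) :
          ∃ y ∈ ({toUniv ρ (fHat H k), univJ ρ (toUniv ρ (fHat H k))} : Set (Univ ρ)),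
            toStd ρ y = x := by
        obtain rfl | rfl := h
        · exact ⟨_, Or.inl rfl, rfl⟩
        · exact ⟨_, Or.inr rfl, rfl⟩
      obtain ⟨x, hx, rfl⟩ := lift hi
      obtain ⟨y, hy, rfl⟩ := lift hj
      exact serre_relation ρ ((le_sup_right : idealMinus ρ ≤ serreIdeal ρ)
        (LieSubmodule.subset_lieSpan ⟨i, j, hij, x, hx, y, hy, rfl⟩))
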